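/- **Model.** $n\ge 1$ identical devices, which do not know $n$, share one channel. Time is divided into slots, and all devices start simultaneously in the same initial state. In each slot a device either transmits a message from a message space $\mathcal M$ (an arbitrary set), listens, or is idle; listening and transmitting cost one unit of energy each, idling is free. The channel carries *silence* if no device transmits, the message $m$ if exactly one device transmits $m$, and *noise* if at least two devices transmit. A listener receives this signal and an idle device receives nothing. In the *Strong-CD* model a transmitting device receives the signal too; in the *Receiver-CD* model it receives nothing. The state of a device is the list of its past actions, received signals and private coin values. An algorithm designates some states as terminal, each with an output (a device in a terminal state stops), and specifies for every other state the probability distribution of the next (private coin, action); all devices draw independently. An algorithm *solves a problem within time $T(n)$ with failure probability at most $1/n$* if for every $n\ge1$, when it is run on $n$ devices, with probability at least $1-1/n$ all devices have terminated within $T(n)$ slots and the requirement of the problem holds; in a failed execution the devices may behave arbitrarily. The requirements are: * *Approximate Counting* with constant factor $c\ge1$: all devices output the same $\tilde n$, and $n/c\le\tilde n\le cn$. * *Leader Election*: exactly one device outputs "leader" and all others "follower", and the execution of all devices ends with one slot in which the leader transmits and every follower listens. * *Contention resolution*: every device has a slot in which it is the only device that transmits. Let $\log^* n$ be the number of times $\log_2$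 has to be applied to $n$ until the result is at most $1$. For a function $T$ and $d_1\in\mathbb N$ let $d_{i+1}=T\bigl(2^{2^{2^{2^{d_i}}}}\bigr)$ for $i\ge 1$. **Theorem.** There is an absolute constant $\kappa>0$ such that the following hold in the Strong-CD model and in the Receiver-CD model. 1. Let $\mathcal A$ be a randomized algorithm that solves Approximate Counting (with any constant factor $c\ge 1$), Leader Election or contention resolution within polynomial time with failure probability at most $1/n$. Then the energy cost of $\mathcal A$ is $\Omega(\log(\log^* n))$, in the following sense: for every sufficiently large $n$ there is a network size $n'$ with $2\le n'\le n$ such that, when $\mathcal A$ is executed on $n'$ devices, with probability at least $1-n'^{-7}$ some device spends at least $\kappa\log(\log^* n)$ units of energy. 2. For every $c\ge1$ there is $D$ such that the following holds for every $d_1\ge D$. Let $T$ be a nondecreasing function with $T(n)\ge n$, and let $\mathcal A$ be an algorithm that solves Approximate Counting with factor $c$ within time $T(n)$ with failure probability at most $1/n$. Then for every integer $k\ge3$ there is a network size $n$ with $d_1\le n\le d_{k+1}$ such that, when $\mathcal A$ is executed on $n$ devices, with probability at least $1-n^{-7}$ some device spends at least $\kappa\log k$ units of energy. -/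

import Mathlib

open scoped ENNReal

universe u v w

noncomputable section

namespace RadioNet

/-- What a device can do in one time slot. -/
inductive Action (M : Type v) : Type v
  | idle : Action M
  | listen : Action M
  | transmit (m : M) : Action M

/-- The message sent, if any. -/
def Action.sent {M : Type v} : Action M → Option M
  | .transmit m => some m
  | _ => none

/-- The energy spent by an action: transmitting and listening cost one unit each. -/
def Action.cost {M : Type v} : Action M → ℕ
  | .idle => 0
  | .listen => 1
  | .transmit _ => 1

/-- The state of the channel in one time slot. -/
inductive Signal (M : Type v) : Type v
  | silence : Signal M
  | noise : Signal M
  | message (m : M) : Signal M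

/-- The state of the channel when the messages in the list are transmitted simultaneously. -/
def channel {M : Type v} : List M → Signal M
  | [] => .silence
  | [m] => .message m
  | _ :: _ :: _ => .noise

/-- The two collision-detection models in which listeners distinguish silence from noise. In
`strong` senders receive the channel signal as well, in `receiver` senders receive no signal. -/
inductive CDModel : Type
  | strong : CDModel
  | receiver : CDModel

/-- The signal received by a device that performed the given action (`none`: no signal). -/
def feedback {M : Type v} : CDModel → Signal M → Action M → Option (Signal M)
  | _, _, .idle => none
  | _, s, .listen => some s
  | .strong, s, .transmit _ => some s
  | .receiver, _, .transmit _ => none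

/-- What one device experiences in one time slot: the value of its private coin, the action it
performed, and the signal it received. -/
structure Entry (R : Type u) (M : Type v) : Type (max u v) where
  coin : R
  action : Action M
  heard : Option (Signal M)

/-- The state of a device: all it has experienced, in chronological order. The entry with index
`t` belongs to time slot `t` (slots are numbered from `0`). The empty list is the common initial
state of all devices. -/
abbrev History (R : Type u) (M : Type v) : Type (max u v) := List (Entry R M)

/-- A randomized algorithm with private coins in `R`, message space `M` and outputs in `Out`. All
devices run it, and it does not know the number of devices. A state `h` with `output h = some o`
is terminal, with output `o`; in any other state the device draws a private coin and an action
for the next time slot from the distribution `act h`. -/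
structure Algorithm (R : Type u) (M : Type v) (Out : Type w) : Type (max u v w) where
  output : History R M → Option Out
  act : History R M → PMF (R × Action M)

/-- The joint distribution of independent random variables with the given distributions. -/
def indep {α : Type u} : (n : ℕ) → (Fin n → PMF α) → PMF (Fin n → α)
  | 0, _ => PMF.pure Fin.elim0
  | n + 1, p =>
      (p 0).bind fun a => (indep n fun i => p i.succ).map fun f => Fin.cons a f

variable {R : Type u} {M : Type v} {Out : Type w} {n : ℕ}

/-- The random choice of a device in state `h`; `none` if the device has terminated. -/
def Algorithm.choice (A : Algorithm R M Out) (h : History R M) :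
    PMF (Option (R × Action M)) :=
  match A.output h with
  | some _ => PMF.pure none
  | none => (A.act h).map some

/-- The messages transmitted in a time slot, given the choices of all devices. -/
def transmissions (x : Fin n → Option (R × Action M)) : List M :=
  (List.ofFn x).filterMap fun c => c.bind fun ra => ra.2.sent

/-- The new state of a device in state `h` with the given choice, when the channel is in state
`s`. The state of a terminated device does not change any more. -/
def update (model : CDModel) (s : Signal M) (h : History R M) :
    Option (R × Action M) → History R M
  | none => h
  | some (r, a) => h ++ [⟨r, a, feedback model s a⟩]

/-- One time slot of an execution on `n` devices. -/
def Algorithm.step (A : Algorithm R M Out) (model : CDModel) (σ : Fin n → History R M) :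
    PMF (Fin n → History R M) :=
  (indep n fun i => A.choice (σ i)).map fun x i =>
    update model (channel (transmissions x)) (σ i) (x i)

/-- The distribution of the states of `n` devices after `t` time slots. -/
def Algorithm.run (A : Algorithm R M Out) (model : CDModel) (n : ℕ) :
    ℕ → PMF (Fin n → History R M)
  | 0 => PMF.pure fun _ => []
  | t + 1 => (A.run model n t).bind (A.step model)

/-- The energy spent by a device. -/
def energy (h : History R M) : ℕ := (h.map fun e => e.action.cost).sum

/-- The probability that, in an execution on `n` devices, some device spends at least `x` units
of energy. (The events "by time `t`" increase with `t`, so the supremum is the probability of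
their union over all `t`.) -/
def Algorithm.probEnergyAtLeast (A : Algorithm R M Out) (model : CDModel) (n : ℕ) (x : ℝ) :
    ℝ≥0∞ :=
  ⨆ t : ℕ, (A.run model n t).toOuterMeasure {σ | ∃ s, x ≤ (energy (σ s) : ℝ)}

/-- The device with state `h` transmitted in time slot `t`. -/
def TransmitsAt (h : History R M) (t : ℕ) : Prop :=
  ∃ e, h[t]? = some e ∧ ∃ m, e.action = .transmit m

/-- The device with state `h` listened in time slot `t`. -/
def ListensAt (h : History R M) (t : ℕ) : Prop :=
  ∃ e, h[t]? = some e ∧ e.action = .listen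

/-- A criterion that says when the final states of `n` devices, under a given algorithm, are a
successful outcome. -/
abbrev Criterion (R : Type u) (M : Type v) (Out : Type w) :=
  Algorithm R M Out → (n : ℕ) → (Fin n → History R M) → Prop

/-- Approximate Counting with approximation factor `c`: all devices have terminated, with a common
output within a factor `c` of the number of devices. -/
def ApproximateCounting (c : ℝ) : Criterion R M ℝ := fun A n σ =>
  ∃ est : ℝ, (n : ℝ) / c ≤ est ∧ est ≤ c * n ∧ ∀ s, A.output (σ s) = some est

/-- The outputs of Leader Election. -/
inductive Role : Type
  | leader : Role
  | follower : Role

/-- Leader Election: all devices have terminated, exactly one as the leader and all others as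
followers, and the last time slot is one in which the leader transmitted and every follower
listened. -/
def LeaderElection : Criterion R M Role := fun A n σ =>
  ∃ l : Fin n, A.output (σ l) = some .leader ∧ (∀ s, s ≠ l → A.output (σ s) = some .follower) ∧
    ∃ t : ℕ, (∀ s, (σ s).length = t + 1) ∧ TransmitsAt (σ l) t ∧ ∀ s, s ≠ l → ListensAt (σ s) t

/-- Contention resolution: all devices have terminated, and each device had a time slot in which
it was the only one to transmit. -/
def ContentionResolution : Criterion R M Out := fun A n σ =>
  ∀ s : Fin n, (A.output (σ s)).isSome ∧
    ∃ t : ℕ, TransmitsAt (σ s) t ∧ ∀ s', s' ≠ s → ¬ TransmitsAt (σ s') t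

/-- On `n` devices, for every `n ≥ 1`, the algorithm achieves the criterion within `T n` time
slots with failure probability at most `1 / n`. In a failed execution the devices may behave
arbitrarily. -/
def Algorithm.Solves (A : Algorithm R M Out) (model : CDModel) (P : Criterion R M Out)
    (T : ℕ → ℕ) : Prop :=
  ∀ n : ℕ, 1 ≤ n → (A.run model n (T n)).toOuterMeasure {σ | ¬ P A n σ} ≤ (n : ℝ≥0∞)⁻¹

/-- The time bound `T` is polynomial. -/
def PolyTime (T : ℕ → ℕ) : Prop := ∃ p : Polynomial ℕ, ∀ n, T n ≤ p.eval n

/-- The iterated logarithm: the number of times the binary logarithm has to be applied to `n`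
until the result is at most `1`. -/
def logStar (n : ℕ) : ℕ := sInf {k : ℕ | (Real.logb 2)^[k] (n : ℝ) ≤ 1}

/-- The energy cost is at least `f`: for all large `n` there is a network size `n' ≤ n` such that,
on `n'` devices, some device spends at least `f n` units of energy with probability at least
`1 - n' ^ (-7)`. -/
def Algorithm.EnergyCostAtLeast (A : Algorithm R M Out) (model : CDModel) (f : ℕ → ℝ) : Prop :=
  ∀ᶠ n : ℕ in Filter.atTop, ∃ n' : ℕ, 2 ≤ n' ∧ n' ≤ n ∧
    1 - ((n' : ℝ≥0∞) ^ 7)⁻¹ ≤ A.probEnergyAtLeast model n' (f n)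

/-- The checkpoints for the time bound `T` and the first checkpoint `d`, numbered from `0`. -/
def checkpoint (T : ℕ → ℕ) (d : ℕ) : ℕ → ℕ
  | 0 => d
  | i + 1 => T (2 ^ 2 ^ 2 ^ 2 ^ checkpoint T d i)

end RadioNet

end

/-! Fix a deadline `d` and feed a device a deterministic prediction `F : ℕ → Bool` (noise or
silence) instead of the real channel, so that the devices become independent. If in every slot the
probability that one device transmits is at most `n ^ (-16)` or at least `n ^ (-1/2)`, then `n` such
devices really produce silence or noise, respectively, up to error `n ^ (-10)`. Only `d * 2 ^ d`
pairs of a slot and a past prediction matter before `d`, so some doubly exponential scale is avoided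
by all these probabilities: this yields a predictable size `n` (`exists_predictableNetwork`), and
`Predicts.ex_run_le` and `Predicts.le_ex_run` couple the true execution with the independent
devices.

Take deadlines `D i` such that `D (i + 1)` exceeds both the predictable size `n i` and the running
time on it. One unit of energy reveals at most one predicted bit, so `E` units cannot tell `2 ^ E`
networks apart. In averaged form, the probabilities that a pair is not separated and the
probabilities of spending `E` units add up to at least 1 (`one_le_pairs_add_costs`). If in none of
these networks some device spends `E` with high probability, independence makes the second kind
small, so some pair `i < j` stays unseparated with probability greater than `1 / (2 * 4 ^ E)`
(`exists_pairProb_gt`).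

An unseparated device is idle from `D i` on and is active only where both predictions agree, so it
behaves alike in both networks. In Approximate Counting it would report at most `c * n i`, which is
wrong for the much larger `n j`. In Leader Election and contention resolution, success for such a
device requires a slot with a single transmission before `D i`, where only silence and noise are
predicted. Either event has probability `O(1 / n i)`, a contradiction. Among `k` deadlines `E` can
be of order `log k`, and for polynomial time `k` is at least of order `√(log* n)`. -/

noncomputable section

namespace RadioNet

/-! ### Expectations and indicators. -/

section Expectation

variable {α β γ : Type*}

/-- The expectation of a nonnegative function. -/
def ex (p : PMF α) (f : α → ℝ≥0∞) : ℝ≥0∞ := ∑' a, p a * f a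

open Classical in
/-- The truth value of a proposition as a number. -/
def ind (P : Prop) : ℝ≥0∞ := if P then 1 else 0

theorem ind_true {P : Prop} (h : P) : ind P = 1 := by simp [ind, h]

theorem ind_false {P : Prop} (h : ¬ P) : ind P = 0 := by simp [ind, h]

theorem ind_le_one (P : Prop) : ind P ≤ 1 := by unfold ind; split_ifs <;> simp

theorem ind_mono {P Q : Prop} (h : P → Q) : ind P ≤ ind Q := by
  by_cases hP : P
  · rw [ind_true hP, ind_true (h hP)]
  · rw [ind_false hP]; exact zero_le

theorem ind_or_le (P Q : Prop) : ind (P ∨ Q) ≤ ind P + ind Q := by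
  by_cases hP : P
  · rw [ind_true hP, ind_true (Or.inl hP)]; exact le_self_add
  · rw [ind_false hP, zero_add]; exact ind_mono fun h => h.resolve_left hP

theorem ind_add_not (P : Prop) : ind P + ind (¬ P) = 1 := by
  by_cases hP : P <;> simp [ind, hP]

theorem ex_pure (a : α) (f : α → ℝ≥0∞) : ex (PMF.pure a) f = f a := by
  unfold ex
  rw [tsum_eq_single a]
  · simp
  · intro b hb; simp [hb]

theorem ex_bind (p : PMF α) (q : α → PMF β) (f : β → ℝ≥0∞) :
    ex (p.bind q) f = ex p fun a => ex (q a) f := by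
  unfold ex
  simp only [PMF.bind_apply, ← ENNReal.tsum_mul_right, ← ENNReal.tsum_mul_left]
  rw [ENNReal.tsum_comm]
  simp only [mul_assoc]

theorem ex_map (p : PMF α) (u : α → β) (f : β → ℝ≥0∞) :
    ex (p.map u) f = ex p fun a => f (u a) := by
  rw [← PMF.bind_pure_comp, ex_bind]
  simp [ex_pure]

theorem ex_comm (p : PMF α) (q : PMF β) (f : α → β → ℝ≥0∞) :
    (ex p fun a => ex q fun b => f a b) = ex q fun b => ex p fun a => f a b := by
  unfold ex
  simp only [← ENNReal.tsum_mul_left]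
  rw [ENNReal.tsum_comm]
  simp only [mul_left_comm]

theorem ex_mono_support {p : PMF α} {f g : α → ℝ≥0∞} (h : ∀ a ∈ p.support, f a ≤ g a) :
    ex p f ≤ ex p g := by
  refine ENNReal.tsum_le_tsum fun a => ?_
  by_cases ha : a ∈ p.support
  · gcongr; exact h a ha
  · rw [PMF.mem_support_iff, not_not] at ha; simp [ha]

theorem ex_mono {p : PMF α} {f g : α → ℝ≥0∞} (h : ∀ a, f a ≤ g a) : ex p f ≤ ex p g :=
  ex_mono_support fun a _ => h a

theorem ex_congr_support {p : PMF α} {f g : α → ℝ≥0∞} (h : ∀ a ∈ p.support, f a = g a) :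
    ex p f = ex p g :=
  le_antisymm (ex_mono_support fun a ha => (h a ha).le) (ex_mono_support fun a ha => (h a ha).ge)

theorem ex_const (p : PMF α) (c : ℝ≥0∞) : ex p (fun _ => c) = c := by
  unfold ex; rw [ENNReal.tsum_mul_right, p.tsum_coe, one_mul]

theorem ex_add (p : PMF α) (f g : α → ℝ≥0∞) :
    ex p (fun a => f a + g a) = ex p f + ex p g := by
  unfold ex; simp only [mul_add]; exact ENNReal.tsum_add

theorem ex_mul_right (p : PMF α) (f : α → ℝ≥0∞) (c : ℝ≥0∞) :
    ex p (fun a => f a * c) = ex p f * c := by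
  unfold ex; simp only [← mul_assoc]; exact ENNReal.tsum_mul_right

theorem ex_sum {ι : Type*} (p : PMF α) (s : Finset ι) (f : ι → α → ℝ≥0∞) :
    ex p (fun a => ∑ i ∈ s, f i a) = ∑ i ∈ s, ex p (f i) := by
  classical
  induction s using Finset.induction_on with
  | empty => simp [ex]
  | insert i s hi ih => simp only [Finset.sum_insert hi, ex_add, ih]

theorem ex_le_one {p : PMF α} {f : α → ℝ≥0∞} (h : ∀ a, f a ≤ 1) : ex p f ≤ 1 :=
  (ex_mono h).trans (ex_const p 1).le

theorem one_le_ex {p : PMF α} {f : α → ℝ≥0∞} (h : ∀ a ∈ p.support, 1 ≤ f a) : 1 ≤ ex p f :=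
  (ex_const p 1).ge.trans (ex_mono_support h)

theorem toOuterMeasure_eq_ex (p : PMF α) (P : α → Prop) :
    p.toOuterMeasure {a | P a} = ex p fun a => ind (P a) := by
  rw [PMF.toOuterMeasure_apply]
  refine tsum_congr fun a => ?_
  by_cases h : P a <;> simp [ind, h]

theorem ex_ind_not (p : PMF α) (P : α → Prop) :
    (ex p fun a => ind (P a)) + (ex p fun a => ind (¬ P a)) = 1 := by
  rw [← ex_add]; simp only [ind_add_not, ex_const]

end Expectation

/-! ### Independent sampling. -/

section Independent

variable {α : Type u} {β : Type v} {n : ℕ}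

theorem ex_indep_succ (p : Fin (n + 1) → PMF α) (f : (Fin (n + 1) → α) → ℝ≥0∞) :
    ex (indep (n + 1) p) f =
      ex (p 0) fun a => ex (indep n fun i => p i.succ) fun x => f (Fin.cons a x) := by
  simp only [indep, ex_bind, ex_map]

theorem ex_indep_apply (p : Fin n → PMF α) (i : Fin n) (f : α → ℝ≥0∞) :
    ex (indep n p) (fun x => f (x i)) = ex (p i) f := by
  induction n with
  | zero => exact i.elim0
  | succ n ih =>
    rw [ex_indep_succ]
    cases i using Fin.cases with
    | zero => simp [ex_const]
    | succ i => simp [ih (fun i => p i.succ) i, ex_const]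

/-- Draws in different coordinates commute, so two stages can be run coordinate by coordinate. This
keeps the predicted process a product when it advances by one slot. -/
theorem ex_indep_bind (p : Fin n → PMF α) (q : Fin n → α → PMF β)
    (f : (Fin n → β) → ℝ≥0∞) :
    (ex (indep n p) fun x => ex (indep n fun i => q i (x i)) f) =
      ex (indep n fun i => (p i).bind (q i)) f := by
  induction n with
  | zero =>
    simp [indep, ex_pure]
  | succ n ih =>
    simp only [ex_indep_succ, ex_bind, Fin.cons_zero, Fin.cons_succ]
    refine congrArg (ex (p 0)) (funext fun a => ?_)
    rw [ex_comm]
    refine congrArg (ex (q 0 a)) (funext fun b => ?_)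
    exact ih (fun i => p i.succ) (fun i => q i.succ) fun y => f (Fin.cons b y)

theorem indep_pure (a : Fin n → α) : (indep n fun i => PMF.pure (a i)) = PMF.pure a := by
  induction n with
  | zero => simp only [indep]; congr 1; exact Subsingleton.elim _ _
  | succ n ih =>
    rw [indep, PMF.pure_bind, ih fun i => a i.succ, PMF.pure_map]
    congr 1
    exact Fin.cons_self_tail a

theorem ex_indep_map (p : Fin n → PMF α) (u : Fin n → α → β) (f : (Fin n → β) → ℝ≥0∞) :
    (ex (indep n p) fun x => f fun i => u i (x i)) =
      ex (indep n fun i => (p i).map (u i)) f := by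
  have h := ex_indep_bind p (fun i a => PMF.pure (u i a)) f
  simp only [indep_pure, ex_pure] at h
  rw [h]
  rfl

theorem ex_indep_forall (p : PMF α) (Q : α → Prop) :
    (ex (indep n fun _ => p) fun x => ind (∀ i, Q (x i))) = (ex p fun a => ind (Q a)) ^ n := by
  induction n with
  | zero => simp [indep, ex_pure, ind]
  | succ n ih =>
    rw [ex_indep_succ, pow_succ', ← ih, ← ex_mul_right]
    refine congrArg (ex p) (funext fun a => ?_)
    by_cases ha : Q a
    · simp [Fin.forall_fin_succ, ha, ind_true trivial]
    · simp [Fin.forall_fin_succ, ha, ind_false not_false, ex_const]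

theorem mem_support_indep {p : Fin n → PMF α} {x : Fin n → α} (h : x ∈ (indep n p).support)
    (i : Fin n) : x i ∈ (p i).support := by
  induction n with
  | zero => exact i.elim0
  | succ n ih =>
    simp only [indep, PMF.mem_support_bind_iff, PMF.support_map, Set.mem_image] at h
    obtain ⟨a, ha, y, hy, rfl⟩ := h
    cases i using Fin.cases with
    | zero => simpa using ha
    | succ i => simpa using ih (p := fun i => p i.succ) hy i

end Independent

/-! ### How many devices transmit in a slot. -/

section Transmissions

variable {R : Type u} {M : Type v} {n : ℕ}

/-- The message sent according to a choice, if any. -/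
def choiceSent (c : Option (R × Action M)) : Option M := c.bind fun ra => ra.2.sent

theorem transmissions_cons (a : Option (R × Action M)) (x : Fin n → Option (R × Action M)) :
    transmissions (Fin.cons a x : Fin (n + 1) → Option (R × Action M)) =
      (choiceSent a).toList ++ transmissions x := by
  unfold transmissions
  rw [List.ofFn_succ]
  simp only [Fin.cons_zero, Fin.cons_succ, List.filterMap_cons]
  rw [show (a.bind fun ra => ra.2.sent) = choiceSent a from rfl]
  cases choiceSent a <;> rfl

theorem transmissions_eq_nil (x : Fin n → Option (R × Action M)) :
    transmissions x = [] ↔ ∀ i, choiceSent (x i) = none := by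
  unfold transmissions choiceSent
  rw [List.filterMap_eq_nil_iff]
  simp [List.mem_ofFn]

/-- The probability that a random choice is a transmission. -/
def probSend (p : PMF (Option (R × Action M))) : ℝ≥0∞ := ex p fun c => ind (choiceSent c ≠ none)

theorem ex_transmissions_ne_nil_le (p : PMF (Option (R × Action M))) :
    (ex (indep n fun _ => p) fun x => ind (transmissions x ≠ [])) ≤ n * probSend p := by
  have h : ∀ x : Fin n → Option (R × Action M),
      ind (transmissions x ≠ []) ≤ ∑ i, ind (choiceSent (x i) ≠ none) := by
    intro x
    by_cases hx : transmissions x = []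
    · rw [ind_false (not_not.2 hx)]; exact zero_le
    · rw [ind_true hx]
      rw [transmissions_eq_nil, not_forall] at hx
      obtain ⟨i, hi⟩ := hx
      rw [← ind_true hi]
      exact Finset.single_le_sum (f := fun i => ind (choiceSent (x i) ≠ none))
        (fun _ _ => zero_le) (Finset.mem_univ i)
  refine (ex_mono h).trans ?_
  rw [ex_sum]
  simp only [fun i => ex_indep_apply (fun _ : Fin n => p) i fun c => ind (choiceSent c ≠ none)]
  simp [probSend]

/-- Condition on the first device: if it is silent, induct; if it transmits, all the others must be
silent. -/
theorem ex_transmissions_length_le_one (p : PMF (Option (R × Action M))) (n : ℕ) :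
    (ex (indep (n + 1) fun _ => p) fun x => ind ((transmissions x).length ≤ 1)) ≤
      (n + 1) * (ex p fun c => ind (choiceSent c = none)) ^ n := by
  set q := ex p fun c => ind (choiceSent c = none) with hq
  induction n with
  | zero => simpa using ex_le_one fun x => ind_le_one _
  | succ n ih =>
    rw [ex_indep_succ]
    have h : ∀ a : Option (R × Action M), (ex (indep (n + 1) fun _ => p) fun x =>
        ind ((transmissions (Fin.cons a x : Fin (n + 2) → _)).length ≤ 1)) ≤
        ind (choiceSent a = none) * ((n + 1) * q ^ n) + q ^ (n + 1) := by
      intro a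
      cases ha : choiceSent a with
      | none =>
        rw [ind_true rfl, one_mul]
        refine le_add_right ?_
        simpa [transmissions_cons, ha] using ih
      | some m =>
        refine le_add_left (le_of_eq ?_)
        rw [hq, ← ex_indep_forall]
        refine congrArg (ex _) (funext fun x => congrArg ind ?_)
        simp [transmissions_cons, ha, ← transmissions_eq_nil]
    refine (ex_mono h).trans (le_of_eq ?_)
    rw [ex_add, ex_mul_right, ex_const, ← hq]
    push_cast
    ring

theorem channel_eq_silence {l : List M} : channel l = .silence ↔ l = [] := by
  rcases l with _ | ⟨a, _ | ⟨b, l⟩⟩ <;> simp [channel]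

theorem channel_eq_noise {l : List M} : channel l = .noise ↔ ¬ l.length ≤ 1 := by
  rcases l with _ | ⟨a, _ | ⟨b, l⟩⟩ <;> simp [channel]

end Transmissions

/-! ### Lengths of states and absorption at termination. -/

section Histories

variable {R : Type u} {M : Type v} {Out : Type w} {n : ℕ}

theorem length_update_le (model : CDModel) (s : Signal M) (h : History R M)
    (c : Option (R × Action M)) : (update model s h c).length ≤ h.length + 1 := by
  rcases c with _ | ⟨r, a⟩ <;> simp [update]

theorem TransmitsAt.lt_length {h : History R M} {t : ℕ} (ht : TransmitsAt h t) :
    t < h.length := by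
  obtain ⟨e, he, -⟩ := ht
  exact (List.getElem?_eq_some_iff.1 he).1

theorem getElem?_append_singleton_eq_some {α : Type*} {l : List α} {a b : α} {t : ℕ} :
    (l ++ [a])[t]? = some b ↔ l[t]? = some b ∨ (t = l.length ∧ a = b) := by
  rcases lt_trichotomy t l.length with h | h | h
  · rw [List.getElem?_append_left h]
    simp [h.ne]
  · subst h
    simp
  · rw [List.getElem?_eq_none (by simp; omega), List.getElem?_eq_none (by omega)]
    simp [h.ne']

theorem transmitsAt_update (model : CDModel) (s : Signal M) (h : History R M)
    (c : Option (R × Action M)) (t : ℕ) :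
    TransmitsAt (update model s h c) t ↔
      TransmitsAt h t ∨ (t = h.length ∧ choiceSent c ≠ none) := by
  rcases c with _ | ⟨r, a⟩
  · simp [update, choiceSent]
  · simp only [update, TransmitsAt, getElem?_append_singleton_eq_some, or_and_right, exists_or]
    refine or_congr_right ⟨?_, ?_⟩
    · rintro ⟨e, ⟨ht, rfl⟩, m, hm⟩
      simp only at hm
      simp [ht, hm, choiceSent, Action.sent]
    · rintro ⟨ht, hc⟩
      refine ⟨_, ⟨ht, rfl⟩, ?_⟩
      cases a <;> simp_all [choiceSent, Action.sent]

/-- The length of a state at time `t`. -/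
def Algorithm.LengthInv (A : Algorithm R M Out) (t : ℕ) (h : History R M) : Prop :=
  h.length ≤ t ∧ (A.output h = none → h.length = t)

theorem Algorithm.eq_none_of_mem_support {A : Algorithm R M Out} {h : History R M}
    {c : Option (R × Action M)} (hc : c ∈ (A.choice h).support) (hh : A.output h ≠ none) :
    c = none := by
  obtain ⟨o, ho⟩ := Option.ne_none_iff_exists'.1 hh
  simpa [Algorithm.choice, ho] using hc

theorem Algorithm.ne_none_of_mem_support {A : Algorithm R M Out} {h : History R M}
    {c : Option (R × Action M)} (hc : c ∈ (A.choice h).support) (hh : A.output h = none) :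
    c ≠ none := by
  rintro rfl
  simp [Algorithm.choice, hh] at hc

theorem Algorithm.choice_of_terminal {A : Algorithm R M Out} {h : History R M}
    (hh : A.output h ≠ none) : A.choice h = PMF.pure none := by
  obtain ⟨o, ho⟩ := Option.ne_none_iff_exists'.1 hh
  simp [Algorithm.choice, ho]

theorem Algorithm.LengthInv.update {A : Algorithm R M Out} {t : ℕ} {h : History R M}
    (hh : A.LengthInv t h) (model : CDModel) (s : Signal M) {c : Option (R × Action M)}
    (hc : c ∈ (A.choice h).support) : A.LengthInv (t + 1) (update model s h c) := by
  by_cases ho : A.output h = none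
  · obtain ⟨⟨r, a⟩, rfl⟩ := Option.ne_none_iff_exists'.1 (A.ne_none_of_mem_support hc ho)
    have := hh.2 ho
    constructor <;> simp [RadioNet.update, this]
  · obtain rfl := A.eq_none_of_mem_support hc ho
    exact ⟨hh.1.trans (Nat.le_succ t), fun h' => absurd h' ho⟩

theorem Algorithm.LengthInv.length_eq {A : Algorithm R M Out} {t : ℕ} {h : History R M}
    (hh : A.LengthInv t h) {c : Option (R × Action M)} (hc : c ∈ (A.choice h).support)
    (hc' : c ≠ none) : h.length = t := by
  by_contra hne
  exact hc' (A.eq_none_of_mem_support hc fun h' => hne (hh.2 h'))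

theorem mem_support_step {A : Algorithm R M Out} {model : CDModel} {σ σ' : Fin n → History R M}
    (h : σ' ∈ (A.step model σ).support) :
    ∃ x : Fin n → Option (R × Action M), (∀ i, x i ∈ (A.choice (σ i)).support) ∧
      σ' = fun i => update model (channel (transmissions x)) (σ i) (x i) := by
  simp only [Algorithm.step, PMF.support_map, Set.mem_image] at h
  obtain ⟨x, hx, rfl⟩ := h
  exact ⟨x, mem_support_indep hx, rfl⟩

theorem lengthInv_of_mem_support_run {A : Algorithm R M Out} {model : CDModel} {t : ℕ}
    {σ : Fin n → History R M} (h : σ ∈ (A.run model n t).support) (i : Fin n) :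
    A.LengthInv t (σ i) := by
  induction t generalizing σ with
  | zero =>
    simp only [Algorithm.run, PMF.support_pure, Set.mem_singleton_iff] at h
    subst h
    simp [Algorithm.LengthInv]
  | succ t ih =>
    simp only [Algorithm.run, PMF.mem_support_bind_iff] at h
    obtain ⟨σ₀, h₀, h⟩ := h
    obtain ⟨x, hx, rfl⟩ := mem_support_step h
    exact (ih h₀).update model _ (hx i)

theorem step_eq_of_terminal {A : Algorithm R M Out} {model : CDModel}
    {σ σ' : Fin n → History R M} (h : σ' ∈ (A.step model σ).support) {i : Fin n}
    (hi : A.output (σ i) ≠ none) : σ' i = σ i := by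
  obtain ⟨x, hx, rfl⟩ := mem_support_step h
  simp only [A.eq_none_of_mem_support (hx i) hi, update]

theorem ex_run_mono_of_closed {A : Algorithm R M Out} {model : CDModel}
    {W : (Fin n → History R M) → Prop}
    (hW : ∀ σ, W σ → ∀ σ' ∈ (A.step model σ).support, W σ') {t t' : ℕ} (htt' : t ≤ t') :
    (ex (A.run model n t) fun σ => ind (W σ)) ≤ ex (A.run model n t') fun σ => ind (W σ) := by
  induction t', htt' using Nat.le_induction with
  | base => exact le_rfl
  | succ t' _ ih =>
    refine ih.trans ?_
    rw [Algorithm.run, ex_bind]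
    refine ex_mono fun σ => ?_
    by_cases h : W σ
    · rw [ind_true h]
      exact one_le_ex fun σ' hσ' => (ind_true (hW σ h σ' hσ')).ge
    · rw [ind_false h]; exact zero_le

end Histories

/-! ### One device driven by predicted signals. -/

section SingleDevice

variable {R : Type u} {M : Type v} {Out : Type w}

/-- The predicted signal: noise or silence. -/
def sig (b : Bool) : Signal M := if b then .noise else .silence

/-- One slot of a device that receives the predicted signal. -/
def Algorithm.devStep (A : Algorithm R M Out) (model : CDModel) (F : ℕ → Bool)
    (h : History R M) : PMF (History R M) :=
  (A.choice h).map (update model (sig (F h.length)) h)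

/-- A number of slots of a device that receives the predicted signals. -/
def Algorithm.devRun (A : Algorithm R M Out) (model : CDModel) (F : ℕ → Bool) :
    ℕ → History R M → PMF (History R M)
  | 0, h => PMF.pure h
  | m + 1, h => (A.devStep model F h).bind (A.devRun model F m)

variable (A : Algorithm R M Out) (model : CDModel)

theorem ex_devStep (F : ℕ → Bool) (h : History R M) (f : History R M → ℝ≥0∞) :
    ex (A.devStep model F h) f =
      ex (A.choice h) fun c => f (update model (sig (F h.length)) h c) := by
  rw [Algorithm.devStep, ex_map]

theorem devRun_succ (F : ℕ → Bool) (m : ℕ) (h : History R M) :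
    A.devRun model F (m + 1) h = (A.devRun model F m h).bind (A.devStep model F) := by
  induction m generalizing h with
  | zero => simp [Algorithm.devRun]
  | succ m ih =>
    calc A.devRun model F (m + 1 + 1) h
        = (A.devStep model F h).bind fun h' => A.devRun model F (m + 1) h' := rfl
      _ = (A.devStep model F h).bind fun h' =>
            (A.devRun model F m h').bind (A.devStep model F) := by simp only [ih]
      _ = _ := (PMF.bind_bind _ _ _).symm

theorem devRun_congr {F F' : ℕ → Bool} {m : ℕ} {h : History R M}
    (hF : ∀ t < h.length + m, F t = F' t) : A.devRun model F m h = A.devRun model F' m h := by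
  induction m generalizing h with
  | zero => rfl
  | succ m ih =>
    simp only [Algorithm.devRun, Algorithm.devStep, hF h.length (by omega)]
    rw [PMF.bind_map, PMF.bind_map]
    congr 1
    funext c
    refine ih fun t ht => hF t ?_
    have := length_update_le model (sig (F' h.length)) h c
    omega

theorem devRun_of_terminal {F : ℕ → Bool} {h : History R M} (hh : A.output h ≠ none) (m : ℕ) :
    A.devRun model F m h = PMF.pure h := by
  induction m with
  | zero => rfl
  | succ m ih =>
    rw [Algorithm.devRun, Algorithm.devStep, A.choice_of_terminal hh, PMF.pure_map,
      PMF.pure_bind]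
    exact ih

variable {A model}

theorem lengthInv_of_mem_support_devRun {F : ℕ → Bool} {t : ℕ} {h : History R M}
    (hh : h ∈ (A.devRun model F t []).support) : A.LengthInv t h := by
  induction t generalizing h with
  | zero =>
    simp only [Algorithm.devRun, PMF.support_pure, Set.mem_singleton_iff] at hh
    subst hh
    simp [Algorithm.LengthInv]
  | succ t ih =>
    simp only [devRun_succ, PMF.mem_support_bind_iff, Algorithm.devStep, PMF.support_map,
      Set.mem_image] at hh
    obtain ⟨h₀, hh₀, c, hc, rfl⟩ := hh
    exact (ih hh₀).update model _ hc

/-- The action at each slot in which the two predictions `F` and `F'` differ, and at each slot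
from `d` on, is to be idle. -/
def Unaffected (F F' : ℕ → Bool) (d : ℕ) (h : History R M) : Prop :=
  ∀ t e, h[t]? = some e → e.action = .idle ∨ (t < d ∧ F t = F' t)

theorem unaffected_append {F F' : ℕ → Bool} {d : ℕ} {h : History R M} {e : Entry R M} :
    Unaffected F F' d (h ++ [e]) ↔ Unaffected F F' d h ∧
      (e.action = .idle ∨ (h.length < d ∧ F h.length = F' h.length)) := by
  simp only [Unaffected, getElem?_append_singleton_eq_some]
  constructor
  · exact fun H => ⟨fun t e' he => H t e' (Or.inl he), H _ _ (Or.inr ⟨rfl, rfl⟩)⟩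
  · rintro ⟨H, H'⟩ t e' (he | ⟨rfl, rfl⟩)
    · exact H t e' he
    · exact H'

theorem Unaffected.of_update {F F' : ℕ → Bool} {d : ℕ} {h : History R M} {s : Signal M}
    {c : Option (R × Action M)} (H : Unaffected F F' d (update model s h c)) :
    Unaffected F F' d h := by
  rcases c with _ | ⟨r, a⟩
  · exact H
  · exact (unaffected_append.1 H).1

theorem update_idle (s s' : Signal M) (h : History R M) (r : R) :
    update model s h (some (r, .idle)) = update model s' h (some (r, .idle)) := by
  cases model <;> rfl

/-- An idle slot reveals nothing and in any other slot of an unaffected history both predictions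
agree, so such histories have the same weight under `F` and `F'`. -/
theorem ex_devRun_eq_of_unaffected {F F' : ℕ → Bool} {d : ℕ} (t : ℕ) {f : History R M → ℝ≥0∞}
    (hf : ∀ h, ¬ Unaffected F F' d h → f h = 0) :
    ex (A.devRun model F t []) f = ex (A.devRun model F' t []) f := by
  induction t generalizing f with
  | zero => rfl
  | succ t ih =>
    simp only [devRun_succ, ex_bind, ex_devStep]
    have h1 : ∀ (h : History R M) (c : Option (R × Action M)),
        f (update model (sig (F h.length)) h c) = f (update model (sig (F' h.length)) h c) := by
      rintro h (_ | ⟨r, a⟩)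
      · rfl
      · by_cases ha : a = .idle
        · subst ha
          rw [update_idle]
        · by_cases hF : F h.length = F' h.length
          · rw [hF]
          -- Acting where the predictions differ makes the history affected whichever signal is
          -- appended, so both sides vanish.
          · rw [hf, hf] <;> simp [update, unaffected_append, ha, hF]
    simp only [h1]
    refine ih fun h hh => ?_
    rw [← ex_const (A.choice h) 0]
    exact congrArg (ex _) (funext fun c => hf _ fun H => hh H.of_update)

end SingleDevice

/-! ### Coupling the true execution with independent predicted devices. -/

section Coupling

variable {R : Type u} {M : Type v} {Out : Type w} {n : ℕ}

/-- In each slot before `d`, independent devices that received the predicted signals so far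
produce the predicted signal, up to an error probability `ε`. -/
def Predicts (A : Algorithm R M Out) (model : CDModel) (n d : ℕ) (F : ℕ → Bool) (ε : ℝ≥0∞) :
    Prop :=
  ∀ t < d, (ex (indep n fun _ => (A.devRun model F t []).bind A.choice) fun x =>
    ind (channel (transmissions x) ≠ sig (F t))) ≤ ε

variable {A : Algorithm R M Out} {model : CDModel} {d : ℕ} {F : ℕ → Bool} {ε : ℝ≥0∞}

/-- The two processes share the devices' choices and take the same step unless the real signal
differs from the prediction; each slot adds `ε` to the error. -/
theorem Predicts.ex_run_le (hP : Predicts A model n d F ε) {t : ℕ} (ht : t ≤ d)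
    {g : (Fin n → History R M) → ℝ≥0∞} (hg : ∀ σ, g σ ≤ 1) :
    ex (A.run model n t) g ≤ ex (indep n fun _ => A.devRun model F t []) g + t * ε := by
  induction t generalizing g with
  | zero => simp [Algorithm.run, Algorithm.devRun, indep_pure]
  | succ t ih =>
    rw [Algorithm.run, ex_bind]
    refine (ih (by omega) fun σ => ex_le_one hg).trans ?_
    have key : (ex (indep n fun _ => A.devRun model F t []) fun σ => ex (A.step model σ) g) ≤
        ex (indep n fun _ => A.devRun model F (t + 1) []) g + ε := by
      have h1 : ∀ σ ∈ (indep n fun _ => A.devRun model F t []).support,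
          ex (A.step model σ) g ≤ ex (indep n fun i => A.devStep model F (σ i)) g +
            ex (indep n fun i => A.choice (σ i)) fun x =>
              ind (channel (transmissions x) ≠ sig (F t)) := by
        intro σ hσ
        simp only [Algorithm.step, ex_map, Algorithm.devStep]
        rw [← ex_indep_map (fun i => A.choice (σ i))
          (fun i => update model (sig (F (σ i).length)) (σ i)), ← ex_add]
        refine ex_mono_support fun x hx => ?_
        by_cases hc : channel (transmissions x) = sig (F t)
        · refine le_add_right (le_of_eq (congrArg g (funext fun i => ?_)))
          rw [hc]
          cases hxi : x i with
          | none => rfl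
          | some ra =>
            -- A device that still acts has a history of length `t`, so its own clock reads the
            -- prediction for slot `t`.
            rw [(lengthInv_of_mem_support_devRun (mem_support_indep hσ i)).length_eq
              (mem_support_indep hx i) (by simp [hxi])]
        · rw [ind_true hc]
          exact le_add_left (hg _)
      refine (ex_mono_support h1).trans ?_
      rw [ex_add, ex_indep_bind _ (fun _ => A.devStep model F),
        ex_indep_bind _ (fun _ => A.choice)]
      simp only [← devRun_succ]
      gcongr
      exact hP t (by omega)
    calc _ ≤ ex (indep n fun _ => A.devRun model F (t + 1) []) g + ε + t * ε := by gcongr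
      _ = _ := by push_cast; ring

theorem Predicts.le_ex_run (hP : Predicts A model n d F ε) {t : ℕ} (ht : t ≤ d)
    {g : (Fin n → History R M) → ℝ≥0∞} (hg : ∀ σ, g σ ≤ 1) :
    ex (indep n fun _ => A.devRun model F t []) g ≤ ex (A.run model n t) g + t * ε := by
  have h1 := hP.ex_run_le ht (g := fun σ => 1 - g σ) fun σ => tsub_le_self
  have h2 : ∀ p : PMF (Fin n → History R M), ex p g + ex p (fun σ => 1 - g σ) = 1 := by
    intro p
    rw [← ex_add]
    simp only [add_tsub_cancel_of_le (hg _), ex_const]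
  set p := indep n fun _ => A.devRun model F t []
  have h3 : ex p (fun σ => 1 - g σ) ≠ ⊤ :=
    ((ex_le_one fun σ => tsub_le_self).trans_lt ENNReal.one_lt_top).ne
  rw [← ENNReal.add_le_add_iff_right h3, h2]
  calc 1 = ex (A.run model n t) g + ex (A.run model n t) (fun σ => 1 - g σ) := (h2 _).symm
    _ ≤ ex (A.run model n t) g + (ex p (fun σ => 1 - g σ) + t * ε) := by gcongr
    _ = _ := by ring

/-- After `d` nothing is known about the channel, but a device that stays unaffected is idle there
and does not hear it. Hence the coupling error stops growing at `d`. -/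
theorem Predicts.ex_unaffected_le (hP : Predicts A model n d F ε) {F' : ℕ → Bool} {t : ℕ}
    (ht : d ≤ t) (s : Fin n) {f : History R M → ℝ≥0∞} (hf1 : ∀ h, f h ≤ 1)
    (hf : ∀ h, ¬ Unaffected F F' d h → f h = 0) :
    ex (A.devRun model F t []) f ≤ (ex (A.run model n t) fun σ => f (σ s)) + d * ε := by
  induction t, ht using Nat.le_induction generalizing f with
  | base =>
    refine le_trans (le_of_eq ?_) (hP.le_ex_run le_rfl fun σ => hf1 (σ s))
    rw [ex_indep_apply (fun _ => A.devRun model F d [])]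
  | succ t ht ih =>
    rw [devRun_succ, ex_bind, Algorithm.run, ex_bind]
    refine (ih (fun h => ex_le_one hf1) fun h hh => ?_).trans (le_of_eq ?_)
    · rw [ex_devStep, ← ex_const (A.choice h) 0]
      exact congrArg (ex _) (funext fun c => hf _ fun H => hh H.of_update)
    · congr 1
      refine ex_congr_support fun σ hσ => ?_
      rw [ex_devStep, Algorithm.step, ex_map, ← ex_indep_apply (fun i => A.choice (σ i)) s]
      refine ex_congr_support fun x hx => ?_
      change f (update model _ (σ s) (x s)) = f (update model _ (σ s) (x s))
      cases hxs : x s with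
      | none => rfl
      | some ra =>
        obtain ⟨r, a⟩ := ra
        have hl := (lengthInv_of_mem_support_run hσ s).length_eq (mem_support_indep hx s)
          (by simp [hxs])
        by_cases ha : a = .idle
        · subst ha
          rw [update_idle _ (channel (transmissions x))]
        · rw [hf, hf] <;> simp [update, unaffected_append, ha, hl, ht]

/-- In some slot before `d` there is exactly one transmission. -/
def LoneBefore (d : ℕ) (σ : Fin n → History R M) : Prop :=
  ∃ t < d, ∃ s, TransmitsAt (σ s) t ∧ ∀ s', s' ≠ s → ¬ TransmitsAt (σ s') t

theorem length_transmissions_eq_one {n : ℕ} {x : Fin n → Option (R × Action M)} {s : Fin n}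
    (hs : choiceSent (x s) ≠ none) (hs' : ∀ s', s' ≠ s → choiceSent (x s') = none) :
    (transmissions x).length = 1 := by
  induction n with
  | zero => exact s.elim0
  | succ n ih =>
    rw [← Fin.cons_self_tail x, transmissions_cons]
    cases s using Fin.cases with
    | zero =>
      rw [(transmissions_eq_nil (Fin.tail x)).2 fun i => hs' _ (Fin.succ_ne_zero i)]
      obtain ⟨m, hm⟩ := Option.ne_none_iff_exists'.1 hs
      simp [hm]
    | succ s =>
      rw [hs' 0 (Fin.succ_ne_zero s).symm]
      simpa using ih (x := Fin.tail x) hs fun s' h => hs' _ (by simpa using h)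

theorem loneBefore_update {t : ℕ} {σ : Fin n → History R M}
    {x : Fin n → Option (R × Action M)} (hσ : ∀ i, A.LengthInv t (σ i))
    (hx : ∀ i, x i ∈ (A.choice (σ i)).support) {y : Signal M}
    (h : LoneBefore d fun i => update model y (σ i) (x i)) :
    LoneBefore d σ ∨ (t < d ∧ (transmissions x).length = 1) := by
  obtain ⟨t', ht', s, hs, hs'⟩ := h
  simp only [transmitsAt_update] at hs hs'
  by_cases htt : t' = t
  · subst htt
    have hno : ∀ i, ¬ TransmitsAt (σ i) t' := fun i hi =>
      absurd hi.lt_length (not_lt.2 (hσ i).1)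
    refine Or.inr ⟨ht', length_transmissions_eq_one (s := s) (hs.resolve_left (hno s)).2 ?_⟩
    intro i hi
    by_contra hc
    refine hs' i hi (Or.inr ⟨?_, hc⟩)
    refine ((hσ i).length_eq (hx i) ?_).symm
    intro hxi
    simp [hxi, choiceSent] at hc
  · refine Or.inl ⟨t', ht', s, hs.resolve_right ?_, fun i hi H => hs' i hi (Or.inl H)⟩
    rintro ⟨h1, h2⟩
    refine htt (h1.trans ((hσ s).length_eq (hx s) ?_))
    intro hxi
    simp [hxi, choiceSent] at h2

/-- A single transmission contradicts both possible predictions. In each slot before `d` this costs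
at most `d * ε`, coupling included; later slots cannot contribute. -/
theorem Predicts.ex_loneBefore_le (hP : Predicts A model n d F ε) (t : ℕ) :
    (ex (A.run model n t) fun σ => ind (LoneBefore d σ)) ≤ (min t d : ℕ) * (d * ε) := by
  induction t with
  | zero =>
    simp only [Algorithm.run, ex_pure]
    rw [ind_false]
    · exact zero_le
    · rintro ⟨t, -, s, hs, -⟩
      simpa using hs.lt_length
  | succ t ih =>
    rw [Algorithm.run, ex_bind]
    have h1 : ∀ σ ∈ (A.run model n t).support,
        (ex (A.step model σ) fun σ' => ind (LoneBefore d σ')) ≤ ind (LoneBefore d σ) +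
          ex (indep n fun i => A.choice (σ i)) fun x =>
            ind (t < d ∧ (transmissions x).length = 1) := by
      intro σ hσ
      rw [Algorithm.step, ex_map, ← ex_const (indep n fun i => A.choice (σ i))
        (ind (LoneBefore d σ)), ← ex_add]
      refine ex_mono_support fun x hx => (ind_mono ?_).trans (ind_or_le _ _)
      exact loneBefore_update (lengthInv_of_mem_support_run hσ) (mem_support_indep hx)
    refine (ex_mono_support h1).trans ?_
    rw [ex_add]
    by_cases htd : t < d
    · have h2 : (ex (A.run model n t) fun σ => ex (indep n fun i => A.choice (σ i)) fun x =>
          ind (t < d ∧ (transmissions x).length = 1)) ≤ d * ε := by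
        refine (hP.ex_run_le htd.le fun σ => ex_le_one fun x => ind_le_one _).trans ?_
        rw [ex_indep_bind _ (fun _ => A.choice)]
        calc _ ≤ ε + t * ε := by
              gcongr
              refine (ex_mono fun x => ind_mono ?_).trans (hP t htd)
              rintro ⟨-, hx⟩ hc
              cases hF : F t
              · rw [hF, sig, if_neg (by simp), channel_eq_silence] at hc
                simp [hc] at hx
              · rw [hF, sig, if_pos rfl, channel_eq_noise] at hc
                omega
          _ = (t + 1 : ℕ) * ε := by push_cast; ring
          _ ≤ d * ε := by gcongr; omega
      calc _ ≤ (min t d : ℕ) * (d * ε) + d * ε := by gcongr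
        _ = (min (t + 1) d : ℕ) * (d * ε) := by
          rw [min_eq_left htd.le, min_eq_left (by omega)]; push_cast; ring
    · simp only [htd, false_and, ind_false not_false, ex_const, add_zero]
      refine ih.trans ?_
      gcongr
      omega

end Coupling

/-! ### Separating networks costs energy. -/

section DecisionTree

variable {R : Type u} {M : Type v} {Out : Type w} {A : Algorithm R M Out} {model : CDModel}

theorem energy_append (h : History R M) (e : Entry R M) :
    energy (h ++ [e]) = energy h + e.action.cost := by
  simp [energy]

theorem energy_le_energy_update (s : Signal M) (h : History R M) (c : Option (R × Action M)) :
    energy h ≤ energy (update model s h c) := by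
  rcases c with _ | ⟨r, a⟩
  · exact le_rfl
  · rw [update, energy_append]; exact Nat.le_add_right _ _

theorem energy_le_of_mem_support_devRun {F : ℕ → Bool} {m : ℕ} {h h' : History R M}
    (hh : h' ∈ (A.devRun model F m h).support) : energy h ≤ energy h' := by
  induction m generalizing h with
  | zero =>
    simp only [Algorithm.devRun, PMF.support_pure, Set.mem_singleton_iff] at hh
    exact hh ▸ le_rfl
  | succ m ih =>
    simp only [Algorithm.devRun, PMF.mem_support_bind_iff, Algorithm.devStep, PMF.support_map,
      Set.mem_image] at hh
    obtain ⟨_, ⟨c, -, rfl⟩, hh⟩ := hh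
    exact (energy_le_energy_update _ _ _).trans (ih hh)

variable (A model) (d : ℕ → ℕ) (F : ℕ → ℕ → Bool)

/-- The probability that a device in state `h` with predicted signals `F j` has, at time
`d (i + 1)`, a state that does not distinguish the networks `i < j`. -/
def pairProb (i j : ℕ) (h : History R M) : ℝ≥0∞ :=
  if i < j then ex (A.devRun model (F j) (d (i + 1) - h.length) h) fun h' =>
    ind (Unaffected (F i) (F j) (d i) h') else 0

/-- The probability that a device in state `h` with predicted signals `F i` has spent at least
`x` units of energy at time `d i`. -/
def costProb (i x : ℕ) (h : History R M) : ℝ≥0∞ :=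
  ex (A.devRun model (F i) (d i - h.length) h) fun h' => ind (x ≤ energy h')

variable {A model d F}

theorem ex_devRun_eq_ex_choice {G : ℕ → Bool} {D : ℕ} {h : History R M}
    (ho : A.output h = none) (hD : h.length < D) (f : History R M → ℝ≥0∞) :
    ex (A.devRun model G (D - h.length) h) f = ex (A.choice h) fun c =>
      ex (A.devRun model G (D - (update model (sig (G h.length)) h c).length)
        (update model (sig (G h.length)) h c)) f := by
  obtain ⟨m, hm⟩ : ∃ m, D - h.length = m + 1 := ⟨D - h.length - 1, by omega⟩
  rw [hm, Algorithm.devRun, ex_bind, ex_devStep]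
  refine ex_congr_support fun c hc => ?_
  obtain ⟨⟨r, a⟩, rfl⟩ := Option.ne_none_iff_exists'.1 (A.ne_none_of_mem_support hc ho)
  have : D - (update model (sig (G h.length)) h (some (r, a))).length = m := by
    simp [update]; omega
  rw [this]

theorem pairProb_eq {i j : ℕ} {h : History R M} (ho : A.output h = none)
    (hd : i < j → h.length < d (i + 1)) :
    pairProb A model d F i j h =
      ex (A.choice h) fun c => pairProb A model d F i j (update model (sig (F j h.length)) h c) := by
  unfold pairProb
  by_cases hij : i < j
  · simp only [if_pos hij]
    exact ex_devRun_eq_ex_choice ho (hd hij) _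
  · simp only [if_neg hij, ex_const]

theorem costProb_eq {i x : ℕ} {h : History R M} (ho : A.output h = none)
    (hd : h.length < d i) :
    costProb A model d F i x h =
      ex (A.choice h) fun c => costProb A model d F i x (update model (sig (F i h.length)) h c) :=
  ex_devRun_eq_ex_choice ho hd _

/-- `S` is the set of networks still consistent with `h`. Idling keeps `S`; any other action costs
one unit and, by following the majority prediction, at worst halves `S`. The process ends when the
budget `e` is spent, or when the device has stopped or passed `d (i + 1)` with a pair `i < j` left
unseparated. -/
theorem one_le_pairs_add_costs (hd : Monotone d) (N : ℕ) {h : History R M} {S : Finset ℕ} {e : ℕ}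
    (hN : ∀ i ∈ S, d i ≤ h.length + N) (hS : 2 ^ e ≤ S.card)
    (hU : ∀ i ∈ S, ∀ j ∈ S, i < j → Unaffected (F i) (F j) (d i) h) :
    1 ≤ (∑ i ∈ S, ∑ j ∈ S, pairProb A model d F i j h) +
      ∑ i ∈ S, costProb A model d F i (energy h + e) h := by
  induction N using Nat.strong_induction_on generalizing h S e with
  | _ N ih =>
  rcases e with _ | e
  · obtain ⟨i, hi⟩ : S.Nonempty := Finset.card_pos.1 (by simpa using hS)
    have h1 : 1 ≤ costProb A model d F i (energy h + 0) h :=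
      one_le_ex fun h' hh' => (ind_true (by simpa using energy_le_of_mem_support_devRun hh')).ge
    refine le_add_left (h1.trans ?_)
    exact Finset.single_le_sum (f := fun i => costProb A model d F i (energy h + 0) h)
      (fun _ _ => zero_le) hi
  by_cases hex : ∃ i ∈ S, ∃ j ∈ S, i < j ∧ (A.output h ≠ none ∨ d (i + 1) ≤ h.length)
  · obtain ⟨i, hi, j, hj, hij, hor⟩ := hex
    have h0 : A.devRun model (F j) (d (i + 1) - h.length) h = PMF.pure h := by
      rcases hor with ho | hl
      · exact devRun_of_terminal A model ho _
      · rw [Nat.sub_eq_zero_of_le hl]; rfl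
    have h1 : 1 ≤ pairProb A model d F i j h := by
      rw [pairProb, if_pos hij, h0, ex_pure, ind_true (hU i hi j hj hij)]
    refine le_add_right (h1.trans ?_)
    refine (Finset.single_le_sum (f := fun j => pairProb A model d F i j h)
      (fun _ _ => zero_le) hj).trans ?_
    exact Finset.single_le_sum (f := fun i => ∑ j ∈ S, pairProb A model d F i j h)
      (fun _ _ => zero_le) hi
  push Not at hex
  have hlt : ∀ i ∈ S, ∀ j ∈ S, i < j → h.length < d (i + 1) := fun i hi j hj hij =>
    (hex i hi j hj hij).2
  have hc1 : 1 < S.card := by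
    have := Nat.one_le_two_pow (n := e)
    rw [pow_succ] at hS
    omega
  obtain ⟨i₀, hi₀, j₀, hj₀, hij₀⟩ : ∃ i ∈ S, ∃ j ∈ S, i < j := by
    obtain ⟨i, hi, j, hj, hij⟩ := Finset.one_lt_card.1 hc1
    rcases lt_or_gt_of_ne hij with h' | h'
    · exact ⟨i, hi, j, hj, h'⟩
    · exact ⟨j, hj, i, hi, h'⟩
  have ho : A.output h = none := (hex i₀ hi₀ j₀ hj₀ hij₀).1
  obtain ⟨N, rfl⟩ : ∃ N', N = N' + 1 := by
    have h1 := hlt i₀ hi₀ j₀ hj₀ hij₀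
    have h2 : d (i₀ + 1) ≤ d j₀ := hd hij₀
    have h3 := hN j₀ hj₀
    exact ⟨N - 1, by omega⟩
  -- `V` is the right-hand side after one more slot. Networks past their deadline are dropped, since
  -- their cost terms no longer evolve.
  set V : Option (R × Action M) → ℝ≥0∞ := fun c =>
    (∑ i ∈ S, ∑ j ∈ S, pairProb A model d F i j (update model (sig (F j h.length)) h c)) +
      ∑ i ∈ S.filter (h.length < d ·), costProb A model d F i (energy h + (e + 1))
        (update model (sig (F i h.length)) h c) with hV
  have hVle : ex (A.choice h) V ≤ (∑ i ∈ S, ∑ j ∈ S, pairProb A model d F i j h) +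
      ∑ i ∈ S, costProb A model d F i (energy h + (e + 1)) h := by
    rw [hV, ex_add, ex_sum, ex_sum]
    simp only [ex_sum]
    refine add_le_add (le_of_eq ?_) ?_
    · refine Finset.sum_congr rfl fun i hi => Finset.sum_congr rfl fun j hj => ?_
      exact (pairProb_eq ho (hlt i hi j hj)).symm
    · refine le_trans (le_of_eq ?_) (Finset.sum_le_sum_of_subset
        (Finset.filter_subset (h.length < d ·) S))
      refine Finset.sum_congr rfl fun i hi => (costProb_eq ho (Finset.mem_filter.1 hi).2).symm
  refine le_trans (one_le_ex fun c hc => ?_) hVle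
  obtain ⟨⟨r, a⟩, rfl⟩ := Option.ne_none_iff_exists'.1 (A.ne_none_of_mem_support hc ho)
  by_cases ha : a = .idle
  · subst ha
    set h' := update model (sig false) h (some (r, .idle)) with hh'
    have hupd : ∀ s, update model s h (some (r, .idle)) = h' := fun s => update_idle _ _ _ _
    have hen : energy h' = energy h := by simp [hh', update, energy_append, Action.cost]
    have hlen : h'.length = h.length + 1 := by simp [hh', update]
    have key := ih N (by omega) (h := h') (S := S) (e := e + 1)
      (fun i hi => by have := hN i hi; omega) hS (fun i hi j hj hij => by
        rw [hh', update, unaffected_append]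
        exact ⟨hU i hi j hj hij, Or.inl rfl⟩)
    refine key.trans ?_
    simp only [hV, hupd, hen]
    refine add_le_add le_rfl (le_of_eq ?_)
    rw [Finset.sum_filter]
    refine Finset.sum_congr rfl fun i _ => ?_
    split_ifs with hi
    · rfl
    -- The induction hypothesis sums over all of `S`, but past the deadline the energy is frozen
    -- below the target, so the dropped terms are zero.
    · rw [costProb, Nat.sub_eq_zero_of_le (by omega), Algorithm.devRun, ex_pure, ind_false]
      omega
  -- At most one network, the smallest, is past its deadline. The other `2 ^ (e + 1) - 1` or more
  -- split by predicted bit, and one part has at least `2 ^ e`.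
  · have hcard : ∃ b, 2 ^ e ≤ (S.filter fun i => h.length < d i ∧ F i h.length = b).card := by
      have h1 : (S.filter fun i => ¬ h.length < d i).card ≤ 1 := by
        refine Finset.card_le_one.2 fun i hi j hj => ?_
        rw [Finset.mem_filter] at hi hj
        by_contra hij
        rcases lt_or_gt_of_ne hij with h' | h'
        · have := hlt i hi.1 j hj.1 h'
          have : d (i + 1) ≤ d j := hd h'
          omega
        · have := hlt j hj.1 i hi.1 h'
          have : d (j + 1) ≤ d i := hd h'
          omega
      have h2 := Finset.card_filter_add_card_filter_not (s := S) (fun i => h.length < d i)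
      have h3 := Finset.card_filter_add_card_filter_not
        (s := S.filter fun i => h.length < d i) (fun i => F i h.length = true)
      simp only [Finset.filter_filter, Bool.not_eq_true] at h3
      rw [pow_succ] at hS
      by_contra! hb
      have hbt := hb true
      have hbf := hb false
      omega
    obtain ⟨b, hb⟩ := hcard
    set S' := S.filter fun i => h.length < d i ∧ F i h.length = b with hS'
    set h' := update model (sig b) h (some (r, a)) with hh'
    have hsub : S' ⊆ S := Finset.filter_subset _ _
    have hmem : ∀ i ∈ S', h.length < d i ∧ F i h.length = b := fun i hi =>
      (Finset.mem_filter.1 hi).2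
    have hen : energy h' + e = energy h + (e + 1) := by
      have : a.cost = 1 := by cases a <;> simp_all [Action.cost]
      simp [hh', update, energy_append, this]; omega
    have hlen : h'.length = h.length + 1 := by simp [hh', update]
    have key := ih N (by omega) (h := h') (S := S') (e := e)
      (fun i hi => by have := hN i (hsub hi); omega) hb (fun i hi j hj hij => by
        rw [hh', update, unaffected_append]
        refine ⟨hU i (hsub hi) j (hsub hj) hij, Or.inr ⟨(hmem i hi).1, ?_⟩⟩
        rw [(hmem i hi).2, (hmem j hj).2])
    refine key.trans ?_
    rw [hen]
    refine add_le_add ?_ ?_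
    · calc _ ≤ ∑ i ∈ S', ∑ j ∈ S,
            pairProb A model d F i j (update model (sig (F j h.length)) h (some (r, a))) := by
            refine Finset.sum_le_sum fun i _ => ?_
            refine le_trans (le_of_eq ?_) (Finset.sum_le_sum_of_subset hsub)
            exact Finset.sum_congr rfl fun j hj => by rw [(hmem j hj).2]
        _ ≤ _ := Finset.sum_le_sum_of_subset hsub
    · refine le_trans (le_of_eq ?_) (Finset.sum_le_sum_of_subset
        (Finset.monotone_filter_right S (p := fun i => h.length < d i ∧ F i h.length = b)
          (q := (h.length < d ·)) fun i _ hi => hi.1))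
      exact Finset.sum_congr rfl fun i hi => by rw [(hmem i hi).2]

end DecisionTree

/-! ### Existence of predictable network sizes. -/

theorem one_add_mul_le_one_add_pow (θ : ℝ≥0∞) (k : ℕ) : 1 + k * θ ≤ (1 + θ) ^ k := by
  induction k with
  | zero => simp
  | succ k ih =>
    calc 1 + (k + 1 : ℕ) * θ ≤ (1 + k * θ) * (1 + θ) := by
          have : (1 + k * θ) * (1 + θ) = 1 + (k + 1 : ℕ) * θ + k * θ * θ := by push_cast; ring
          rw [this]; exact le_self_add
      _ ≤ (1 + θ) ^ k * (1 + θ) := by gcongr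
      _ = _ := (pow_succ _ _).symm

/-- Every `r` trials halve the failure probability: `q * (1 + 1/r) ≤ 1`, and `(1 + 1/r) ^ r ≥ 2` by
Bernoulli. -/
theorem pow_mul_two_pow_le_one {p q : ℝ≥0∞} (hpq : p + q = 1) {r : ℕ} (hr : r ≠ 0)
    (hp : (r : ℝ≥0∞)⁻¹ ≤ p) (m : ℕ) : q ^ (r * m) * 2 ^ m ≤ 1 := by
  have hq : q ≤ 1 := hpq ▸ le_add_self
  have h1 : q * (1 + (r : ℝ≥0∞)⁻¹) ≤ 1 := by
    calc q * (1 + (r : ℝ≥0∞)⁻¹) = q * (r : ℝ≥0∞)⁻¹ + q := by ring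
      _ ≤ 1 * p + q := by gcongr
      _ = 1 := by rw [one_mul, hpq]
  have h2 : (2 : ℝ≥0∞) ≤ (1 + (r : ℝ≥0∞)⁻¹) ^ r := by
    refine le_trans (le_of_eq ?_) (one_add_mul_le_one_add_pow _ r)
    rw [ENNReal.mul_inv_cancel (by simpa using hr) (by simp)]
    norm_num
  calc q ^ (r * m) * 2 ^ m ≤ q ^ (r * m) * ((1 + (r : ℝ≥0∞)⁻¹) ^ r) ^ m := by gcongr
    _ = (q * (1 + (r : ℝ≥0∞)⁻¹)) ^ (r * m) := by rw [mul_pow, pow_mul (1 + _)]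
    _ ≤ 1 := pow_le_one₀ zero_le h1

theorem mul_sq_le_two_pow {N : ℕ} (hN : 16 ≤ N) : 32 * N ^ 2 ≤ 2 ^ N := by
  induction N, hN using Nat.le_induction with
  | base => norm_num
  | succ N hN ih => rw [pow_succ 2]; nlinarith

section Existence

variable {R : Type u} {M : Type v} {Out : Type w} (A : Algorithm R M Out) (model : CDModel)

/-- The probability that a device with predicted signals `F` transmits in slot `t`. -/
def sendProb (F : ℕ → Bool) (t : ℕ) : ℝ≥0∞ := probSend ((A.devRun model F t []).bind A.choice)

theorem sendProb_congr {F F' : ℕ → Bool} {t : ℕ} (h : ∀ i < t, F i = F' i) :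
    sendProb A model F t = sendProb A model F' t := by
  unfold sendProb
  rw [devRun_congr A model (by simpa using h)]

/-- The transmission probability in slot `t` depends only on earlier predictions, so the threshold
rule can be solved recursively. -/
theorem exists_threshold_signals (θ : ℝ≥0∞) (d : ℕ) :
    ∃ F : ℕ → Bool, ∀ t < d, (F t = true ↔ θ ≤ sendProb A model F t) := by
  classical
  induction d with
  | zero => exact ⟨fun _ => false, by simp⟩
  | succ d ih =>
    obtain ⟨F, hF⟩ := ih
    have hc : ∀ b, ∀ t ≤ d, sendProb A model (Function.update F d b) t = sendProb A model F t :=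
      fun b t ht => sendProb_congr A model fun i hi => Function.update_of_ne (by omega) _ _
    refine ⟨Function.update F d (decide (θ ≤ sendProb A model F d)), fun t ht => ?_⟩
    rw [hc _ t (by omega)]
    rcases Nat.lt_succ_iff_lt_or_eq.1 ht with h | rfl
    · rw [Function.update_of_ne h.ne]; exact hF t h
    · simp

/-- Steps of 5 in `x` make the forbidden windows disjoint, so each pair of a slot and a prediction
prefix spoils at most one of the `d * 2 ^ d + 1` candidates. All predictions are treated at once
because the eventual one depends on `x`. -/
theorem exists_gap (d : ℕ) (f : (ℕ → Bool) → ℕ → ℝ≥0∞)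
    (hf : ∀ F F' t, (∀ i < t, F i = F' i) → f F t = f F' t) (x₀ : ℕ) :
    ∃ x, x₀ ≤ x ∧ x ≤ x₀ + 5 * (d * 2 ^ d) ∧ ∀ F, ∀ t < d,
      f F t ≤ (2 ^ 2 ^ (x + 4))⁻¹ ∨ (2 ^ 2 ^ (x - 1))⁻¹ ≤ f F t := by
  by_contra! H
  -- Values from `d` on are irrelevant, so filling them with `false` leaves finitely many pairs to
  -- pigeonhole.
  have H' : ∀ y : Fin (d * 2 ^ d + 1), ∃ q : Fin d × (Fin d → Bool),
      (2 ^ 2 ^ (x₀ + 5 * y + 4))⁻¹ < f (fun i => if h : i < d then q.2 ⟨i, h⟩ else false) q.1 ∧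
      f (fun i => if h : i < d then q.2 ⟨i, h⟩ else false) q.1 < (2 ^ 2 ^ (x₀ + 5 * y - 1))⁻¹ := by
    intro y
    obtain ⟨F, t, ht, h1, h2⟩ := H (x₀ + 5 * y) (by omega)
      (by have := y.2; omega)
    refine ⟨⟨⟨t, ht⟩, fun i => F i⟩, ?_⟩
    rw [hf _ F t fun i hi => by simp [hi.trans ht]]
    exact ⟨h1, h2⟩
  choose q hq using H'
  obtain ⟨y, y', hne, hyy⟩ := Fintype.exists_ne_map_eq_of_card_lt q (by simp)
  have key : ∀ y y' : Fin (d * 2 ^ d + 1), q y = q y' → ¬ y < y' := by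
    intro y y' hyy hlt
    have h1 := (hq y).1
    have h2 := (hq y').2
    rw [hyy] at h1
    have h3 := h1.trans h2
    rw [ENNReal.inv_lt_inv] at h3
    refine absurd h3 (not_lt.2 ?_)
    gcongr
    · norm_num
    · norm_num
    · have : (y : ℕ) < y' := hlt
      omega
  rcases lt_or_gt_of_ne hne with h | h
  · exact key _ _ hyy h
  · exact key _ _ hyy.symm h

/-- The channel is predictable before time `d` in a network of size `n`, where `n` is large in
terms of `d`. -/
structure PredictableNetwork (d n : ℕ) (F : ℕ → Bool) : Prop where
  predicts : Predicts A model n d F ((n : ℝ≥0∞) ^ 10)⁻¹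
  lower : ∃ x, 2 ^ d ≤ x ∧ n = 2 ^ 2 ^ x
  upper : n ≤ 2 ^ 2 ^ 2 ^ 2 ^ d

variable {A model}

theorem ex_ne_silence_le {n : ℕ} (p : PMF (Option (R × Action M))) (hn : n ≠ 0)
    (hp : probSend p ≤ ((n : ℝ≥0∞) ^ 16)⁻¹) :
    (ex (indep n fun _ => p) fun x => ind (channel (transmissions x) ≠ .silence)) ≤
      ((n : ℝ≥0∞) ^ 10)⁻¹ := by
  simp only [ne_eq, channel_eq_silence]
  refine (ex_transmissions_ne_nil_le p).trans ?_
  rw [ENNReal.le_inv_iff_mul_le]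
  have h0 : (n : ℝ≥0∞) ≠ 0 := by simpa using hn
  have h1 : (1 : ℝ≥0∞) ≤ n := by exact_mod_cast Nat.one_le_iff_ne_zero.2 hn
  calc (n : ℝ≥0∞) * probSend p * n ^ 10 ≤ n * ((n : ℝ≥0∞) ^ 16)⁻¹ * n ^ 10 := by gcongr
    _ = ((n : ℝ≥0∞) ^ 16)⁻¹ * n ^ 11 := by ring
    _ ≤ ((n : ℝ≥0∞) ^ 16)⁻¹ * n ^ 16 := by gcongr; norm_num
    _ = 1 := ENNReal.inv_mul_cancel (by simp [h0]) (by simp)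

/-- Here `r = 2 ^ z` is the square root of the network size, so the expected number of transmissions
is at least `r`. At most one transmission then has probability exponentially small in `r`, which
beats any fixed power of the size. -/
theorem ex_ne_noise_le {z : ℕ} (p : PMF (Option (R × Action M))) (hz : 16 ≤ z)
    (hp : (2 ^ z : ℝ≥0∞)⁻¹ ≤ probSend p) :
    (ex (indep (2 ^ (2 * z)) fun _ => p) fun x => ind (channel (transmissions x) ≠ .noise)) ≤
      (((2 ^ (2 * z) : ℕ) : ℝ≥0∞) ^ 10)⁻¹ := by
  simp only [ne_eq, channel_eq_noise, not_not]
  obtain ⟨m, hm⟩ : ∃ m, 2 ^ (2 * z) = m + 1 := ⟨2 ^ (2 * z) - 1, by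
    have := Nat.one_le_two_pow (n := 2 * z); omega⟩
  set r := 2 ^ z with hr
  have hr1 : 1 ≤ r := Nat.one_le_two_pow
  have hmr : r * (r - 1) ≤ m := by
    have : r * r = m + 1 := by rw [hr, ← pow_add, ← two_mul, hm]
    rw [Nat.mul_sub, this]
    omega
  set q := ex p fun c => ind (choiceSent c = none) with hq
  have hpq : probSend p + q = 1 := by
    rw [add_comm, probSend, hq]; exact ex_ind_not _ _
  have hq1 : q ≤ 1 := hpq ▸ le_add_self
  have hbig : (m + 1) ^ 11 ≤ 2 ^ (r - 1) := by
    rw [← hm, ← pow_mul]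
    refine Nat.pow_le_pow_right (by norm_num) ?_
    have := mul_sq_le_two_pow hz
    rw [← hr] at this
    have h2 : z * 16 ≤ z ^ 2 := by nlinarith
    omega
  rw [hm]
  refine (ex_transmissions_length_le_one p m).trans ?_
  rw [ENNReal.le_inv_iff_mul_le]
  calc ((m : ℝ≥0∞) + 1) * q ^ m * ((m + 1 : ℕ) : ℝ≥0∞) ^ 10
      = q ^ m * (((m + 1) ^ 11 : ℕ) : ℝ≥0∞) := by push_cast; ring
    _ ≤ q ^ (r * (r - 1)) * ((2 ^ (r - 1) : ℕ) : ℝ≥0∞) := by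
        refine mul_le_mul' (pow_le_pow_of_le_one zero_le hq1 hmr) ?_
        exact_mod_cast hbig
    _ ≤ 1 := by
        push_cast
        refine pow_mul_two_pow_le_one hpq (by omega) ?_ _
        rw [hr]; push_cast; exact hp

theorem five_mul_le {d : ℕ} (hd : 3 ≤ d) : 2 ^ d + 5 * (d * 2 ^ d) ≤ 2 ^ 2 ^ d := by
  induction d, hd using Nat.le_induction with
  | base => norm_num
  | succ d hd ih =>
    have h1 : 2 ^ 3 ≤ 2 ^ d := Nat.pow_le_pow_right (by norm_num) hd
    have h2 : 2 ^ 2 ^ (d + 1) = 2 ^ 2 ^ d * 2 ^ 2 ^ d := by rw [pow_succ 2 d, pow_mul, sq]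
    have h3 : 2 ^ 3 ≤ 2 ^ 2 ^ d := Nat.pow_le_pow_right (by norm_num) (by omega)
    rw [h2, pow_succ 2 d]
    nlinarith

variable (A model) in
-- With `n = 2 ^ 2 ^ x`, the ends of the gap are `n ^ (-16)` and `n ^ (-1/2)`: below it silence is
-- predicted, above it noise. The bound `five_mul_le` gives `x ≤ 2 ^ 2 ^ d`, whence the four
-- exponentials.
theorem exists_predictableNetwork {d : ℕ} (hd : 3 ≤ d) :
    ∃ n F, PredictableNetwork A model d n F := by
  obtain ⟨x, hx1, hx2, hx⟩ := exists_gap d (sendProb A model)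
    (fun F F' t h => sendProb_congr A model h) (2 ^ d)
  obtain ⟨F, hF⟩ := exists_threshold_signals A model (2 ^ 2 ^ (x - 1))⁻¹ d
  have h8 : 2 ^ 3 ≤ 2 ^ d := Nat.pow_le_pow_right (by norm_num) hd
  obtain ⟨y, rfl⟩ : ∃ y, x = y + 1 := ⟨x - 1, by omega⟩
  refine ⟨2 ^ 2 ^ (y + 1), F, ?_, ⟨y + 1, hx1, rfl⟩, ?_⟩
  · intro t ht
    have h := hx F t ht
    cases hFt : F t
    · rw [sig, if_neg (by simp)]
      have h1 : ¬ (2 ^ 2 ^ (y + 1 - 1))⁻¹ ≤ sendProb A model F t := by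
        rw [← hF t ht, hFt]; simp
      refine ex_ne_silence_le _ (by positivity) ((h.resolve_right h1).trans (le_of_eq ?_))
      push_cast
      rw [← pow_mul, pow_add 2 (y + 1) 4]
      norm_num
    · rw [sig, if_pos rfl]
      have h1 := (hF t ht).1 hFt
      rw [pow_succ 2 y, mul_comm]
      refine ex_ne_noise_le _ ?_ h1
      calc 16 ≤ 2 ^ 7 := by norm_num
        _ ≤ 2 ^ y := Nat.pow_le_pow_right (by norm_num) (by omega)
  · refine Nat.pow_le_pow_right (by norm_num) (Nat.pow_le_pow_right (by norm_num) ?_)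
    exact hx2.trans (five_mul_le hd)

end Existence

variable {R : Type u} {M : Type v} {Out : Type w} {A : Algorithm R M Out} {model : CDModel}

/-! ### Estimates inside one predictable network. -/

section Network

variable {d n : ℕ} {F : ℕ → Bool}

theorem PredictableNetwork.exists_two_pow (hN : PredictableNetwork A model d n F) (hd : 3 ≤ d) :
    ∃ N, n = 2 ^ N ∧ 16 ≤ N ∧ 2 ^ 2 ^ d ≤ N ∧ d ≤ N := by
  obtain ⟨x, hx, rfl⟩ := hN.lower
  have h1 : 2 ^ 2 ^ d ≤ 2 ^ x := Nat.pow_le_pow_right (by norm_num) hx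
  have h2 : 2 ^ 3 ≤ 2 ^ d := Nat.pow_le_pow_right (by norm_num) hd
  have h3 : 2 ^ 2 ^ 3 ≤ 2 ^ 2 ^ d := Nat.pow_le_pow_right (by norm_num) h2
  have h4 : d < 2 ^ d := Nat.lt_two_pow_self
  have h5 : 2 ^ d < 2 ^ 2 ^ d := Nat.lt_two_pow_self
  exact ⟨2 ^ x, rfl, by omega, h1, by omega⟩

theorem PredictableNetwork.mul_sq_le (hN : PredictableNetwork A model d n F) (hd : 3 ≤ d) :
    32 * d ^ 2 ≤ n := by
  obtain ⟨N, rfl, h16, -, hdN⟩ := hN.exists_two_pow hd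
  exact le_trans (by gcongr) (mul_sq_le_two_pow h16)

theorem inv_pow_mul_le {n a k l : ℕ} (hn : n ≠ 0) (ha : a ≤ n ^ l) :
    (a : ℝ≥0∞) * ((n : ℝ≥0∞) ^ (k + l))⁻¹ ≤ ((n : ℝ≥0∞) ^ k)⁻¹ := by
  have h0 : (n : ℝ≥0∞) ≠ 0 := by simpa using hn
  rw [ENNReal.le_inv_iff_mul_le]
  calc (a : ℝ≥0∞) * ((n : ℝ≥0∞) ^ (k + l))⁻¹ * n ^ k
      ≤ (n : ℝ≥0∞) ^ l * ((n : ℝ≥0∞) ^ (k + l))⁻¹ * n ^ k := by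
        gcongr; exact_mod_cast ha
    _ = (n : ℝ≥0∞) ^ (k + l) * ((n : ℝ≥0∞) ^ (k + l))⁻¹ := by ring
    _ = 1 := ENNReal.mul_inv_cancel (by simp [h0]) (by simp)

theorem PredictableNetwork.mul_error_le (hN : PredictableNetwork A model d n F) (hd : 3 ≤ d) :
    (d : ℝ≥0∞) * ((n : ℝ≥0∞) ^ 10)⁻¹ ≤ ((n : ℝ≥0∞) ^ 8)⁻¹ := by
  have h := hN.mul_sq_le hd
  exact inv_pow_mul_le (l := 2) (k := 8) (by nlinarith)
    (by calc d ≤ n := by nlinarith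
          _ ≤ n ^ 2 := Nat.le_self_pow (by norm_num) n)

theorem PredictableNetwork.mul_mul_error_le (hN : PredictableNetwork A model d n F)
    (hd : 3 ≤ d) : (d : ℝ≥0∞) * (d * ((n : ℝ≥0∞) ^ 10)⁻¹) ≤ (n : ℝ≥0∞)⁻¹ := by
  have h := hN.mul_sq_le hd
  have hn : 1 ≤ n := by nlinarith
  have h1 := inv_pow_mul_le (n := n) (a := d * d) (l := 9) (k := 1) (by omega)
    (by calc d * d ≤ n := by nlinarith
          _ ≤ n ^ 9 := Nat.le_self_pow (by norm_num) n)
  simpa [mul_assoc] using h1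

theorem PredictableNetwork.mul_error_le_inv (hN : PredictableNetwork A model d n F)
    (hd : 3 ≤ d) : (d : ℝ≥0∞) * ((n : ℝ≥0∞) ^ 10)⁻¹ ≤ (n : ℝ≥0∞)⁻¹ := by
  refine le_trans ?_ (hN.mul_mul_error_le hd)
  exact le_mul_of_one_le_left zero_le (by exact_mod_cast (by omega : 1 ≤ d))

/-- If one predicted device were expensive with probability above `1 / (4 * K)`, then among `n`
independent ones an expensive one would be missing with probability at most `n ^ (-8)`; the coupling
error adds no more than that. -/
theorem PredictableNetwork.ex_energy_le (hN : PredictableNetwork A model d n F) (hd : 3 ≤ d)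
    {K : ℕ} (hK0 : 1 ≤ K) (hK : K ≤ d) {E : ℕ}
    (hE : (ex (A.run model n d) fun σ => ind (∃ s, E ≤ energy (σ s))) <
      1 - ((n : ℝ≥0∞) ^ 7)⁻¹) :
    (ex (A.devRun model F d []) fun h => ind (E ≤ energy h)) ≤ ((4 * K : ℕ) : ℝ≥0∞)⁻¹ := by
  by_contra! hlt
  obtain ⟨N, rfl, h16, -, hdN⟩ := hN.exists_two_pow hd
  set n := 2 ^ N with hn
  have hn2 : 2 ≤ n := by
    calc 2 = 2 ^ 1 := rfl
      _ ≤ 2 ^ N := Nat.pow_le_pow_right (by norm_num) (by omega)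
  set q := ex (A.devRun model F d []) fun h => ind (¬ E ≤ energy h) with hq
  have hpq := ex_ind_not (A.devRun model F d []) fun h => E ≤ energy h
  rw [← hq] at hpq
  have hq1 : q ≤ 1 := hpq ▸ le_add_self
  have h1 := ex_ind_not (A.run model n d) fun σ => ∃ s, E ≤ energy (σ s)
  have h2 : ((n : ℝ≥0∞) ^ 7)⁻¹ <
      ex (A.run model n d) fun σ => ind (¬ ∃ s, E ≤ energy (σ s)) := by
    by_contra hle
    rw [not_lt] at hle
    have h3 : 1 ≤ (ex (A.run model n d) fun σ => ind (∃ s, E ≤ energy (σ s))) +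
        ((n : ℝ≥0∞) ^ 7)⁻¹ := h1.ge.trans (by gcongr)
    exact absurd hE (not_lt.2 (tsub_le_iff_right.2 h3))
  have h3 := hN.predicts.ex_run_le le_rfl (g := fun σ => ind (∀ s, ¬ E ≤ energy (σ s)))
    fun σ => ind_le_one _
  rw [ex_indep_forall _ fun h => ¬ E ≤ energy h, ← hq] at h3
  simp only [not_exists] at h2
  have h4 : q ^ n ≤ ((n : ℝ≥0∞) ^ 8)⁻¹ := by
    rw [ENNReal.le_inv_iff_mul_le]
    -- Blocks of `4 * K` devices each halve the probability, and `8 * N` blocks give `2 ^ (8 * N) =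
    -- n ^ 8`.
    have h5 : 4 * K * (8 * N) ≤ n := by
      refine le_trans ?_ (mul_sq_le_two_pow h16)
      have := Nat.mul_le_mul (hK.trans hdN) (le_refl N)
      nlinarith
    calc q ^ n * (n : ℝ≥0∞) ^ 8 ≤ q ^ (4 * K * (8 * N)) * (n : ℝ≥0∞) ^ 8 := by
          exact mul_le_mul' (pow_le_pow_of_le_one zero_le hq1 h5) le_rfl
      _ = q ^ (4 * K * (8 * N)) * 2 ^ (8 * N) := by
          rw [hn]; push_cast; rw [← pow_mul, mul_comm N 8]
      _ ≤ 1 := pow_mul_two_pow_le_one hpq (by omega) hlt.le _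
  have h6 := inv_pow_mul_le (n := n) (a := 2) (l := 1) (k := 7) (by omega) (by simpa using hn2)
  refine absurd (h2.trans_le (h3.trans ?_)) (lt_irrefl _)
  calc q ^ n + d * ((n : ℝ≥0∞) ^ 10)⁻¹
      ≤ ((n : ℝ≥0∞) ^ 8)⁻¹ + ((n : ℝ≥0∞) ^ 8)⁻¹ := add_le_add h4 (hN.mul_error_le hd)
    _ = ((2 : ℕ) : ℝ≥0∞) * ((n : ℝ≥0∞) ^ (7 + 1))⁻¹ := by norm_num [two_mul]
    _ ≤ _ := h6

end Network

/-- A criterion under which all devices have terminated. -/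
def Criterion.Terminating (P : Criterion R M Out) : Prop :=
  ∀ A n σ, P A n σ → ∀ s, A.output (σ s) ≠ none

/-- Terminated states are frozen, so success at time `T n` persists at every later time. -/
theorem Algorithm.Solves.ex_not_le {P : Criterion R M Out} {T : ℕ → ℕ} (h : A.Solves model P T)
    (hP : P.Terminating) {n t : ℕ} (hn : 1 ≤ n) (ht : T n ≤ t) :
    (ex (A.run model n t) fun σ => ind (¬ P A n σ)) ≤ (n : ℝ≥0∞)⁻¹ := by
  have h1 := h n hn
  rw [toOuterMeasure_eq_ex] at h1
  have h2 := ex_run_mono_of_closed (A := A) (model := model) (W := fun σ => P A n σ)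
    (fun σ hσ σ' hσ' => by
      have : σ' = σ := funext fun i => step_eq_of_terminal hσ' (hP A n σ hσ i)
      rwa [this]) ht
  have h3 := ex_ind_not (A.run model n t) fun σ => P A n σ
  have h4 := ex_ind_not (A.run model n (T n)) fun σ => P A n σ
  refine le_trans ?_ h1
  have h5 : (ex (A.run model n t) fun σ => ind (P A n σ)) ≠ ⊤ :=
    ((ex_le_one fun σ => ind_le_one _).trans_lt ENNReal.one_lt_top).ne
  rw [← ENNReal.add_le_add_iff_left h5, h3, ← h4]
  gcongr

/-! ### Contradiction from an unseparated pair of networks. -/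

section Pairs

variable {D : ℕ → ℕ} {n : ℕ → ℕ} {F : ℕ → ℕ → Bool}

/-- The `K = 2 ^ E` cost terms sum to at most 1/4. If every pair were at most `1 / (2 * K ^ 2)`, the
pair terms would sum to at most 1/2, and the total would stay below 1. -/
theorem exists_pairProb_gt (hD : Monotone D) {i₀ E : ℕ} (h3 : 3 ≤ D i₀) (hE : 2 ^ E ≤ D i₀)
    (hN : ∀ i, i₀ ≤ i → PredictableNetwork A model (D i) (n i) (F i))
    (hcost : ∀ i, i₀ ≤ i → i < i₀ + 2 ^ E →
      (ex (A.run model (n i) (D i)) fun σ => ind (∃ s, E ≤ energy (σ s))) <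
        1 - ((n i : ℝ≥0∞) ^ 7)⁻¹) :
    ∃ i j, i₀ ≤ i ∧ i < j ∧ ((2 * (2 ^ E) ^ 2 : ℕ) : ℝ≥0∞)⁻¹ <
      ex (A.devRun model (F j) (D (i + 1)) []) fun h => ind (Unaffected (F i) (F j) (D i) h) := by
  set K := 2 ^ E with hKdef
  have hK1 : 1 ≤ K := Nat.one_le_two_pow
  set S := Finset.Ico i₀ (i₀ + K) with hS
  have hcard : S.card = K := by simp [hS]
  have hbound : ∀ i ∈ S, D i ≤ ([] : History R M).length + D (i₀ + K) := fun i hi => by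
    have := hD (Finset.mem_Ico.1 hi).2.le
    simpa using this
  have h1 := one_le_pairs_add_costs (A := A) (model := model) (d := D) (F := F) hD
    (D (i₀ + K)) (h := []) (S := S) (e := E) hbound hcard.ge
    (fun i _ j _ _ t e he => by simp at he)
  have h2 : ∑ i ∈ S, costProb A model D F i (energy ([] : History R M) + E) [] ≤ 4⁻¹ := by
    calc _ ≤ ∑ _i ∈ S, ((4 * K : ℕ) : ℝ≥0∞)⁻¹ := by
          refine Finset.sum_le_sum fun i hi => ?_
          have hi' := Finset.mem_Ico.1 hi
          have h := (hN i hi'.1).ex_energy_le (h3.trans (hD hi'.1)) hK1 (hE.trans (hD hi'.1))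
            (hcost i hi'.1 hi'.2)
          simpa [costProb, energy] using h
      _ = K * ((4 * K : ℕ) : ℝ≥0∞)⁻¹ := by rw [Finset.sum_const, hcard, nsmul_eq_mul]
      _ = 4⁻¹ := by
          have hK0 : (K : ℝ≥0∞) ≠ 0 := by simpa using Nat.one_le_iff_ne_zero.1 hK1
          push_cast
          rw [ENNReal.mul_inv (by simp) (by simp), mul_left_comm,
            ENNReal.mul_inv_cancel hK0 (by simp), mul_one]
  by_contra! H
  have h4 : ∑ i ∈ S, ∑ j ∈ S, pairProb A model D F i j [] ≤ 2⁻¹ := by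
    calc _ ≤ ∑ _i ∈ S, ∑ _j ∈ S, ((2 * K ^ 2 : ℕ) : ℝ≥0∞)⁻¹ := by
          refine Finset.sum_le_sum fun i hi => Finset.sum_le_sum fun j _ => ?_
          unfold pairProb
          split_ifs with hij
          · simpa using H i j (Finset.mem_Ico.1 hi).1 hij
          · exact zero_le
      _ = ((K ^ 2 : ℕ) : ℝ≥0∞) * ((2 * K ^ 2 : ℕ) : ℝ≥0∞)⁻¹ := by
          simp only [Finset.sum_const, hcard, nsmul_eq_mul]
          push_cast
          ring
      _ = 2⁻¹ := by
          have hK0 : ((K ^ 2 : ℕ) : ℝ≥0∞) ≠ 0 := by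
            have : K ^ 2 ≠ 0 := by positivity
            exact_mod_cast this
          rw [Nat.cast_mul 2, ENNReal.mul_inv (by simp) (by simp), mul_left_comm,
            ENNReal.mul_inv_cancel hK0 (by simp), mul_one]
          simp
  have h5 : (1 : ℝ≥0∞) ≤ 2⁻¹ + 4⁻¹ := h1.trans (add_le_add h4 h2)
  have h6 : (2⁻¹ + 4⁻¹ : ℝ≥0∞) < 1 := by
    calc (2⁻¹ + 4⁻¹ : ℝ≥0∞) < 2⁻¹ + 2⁻¹ := by
          refine ENNReal.add_lt_add_left (by simp) ?_
          rw [ENNReal.inv_lt_inv]; norm_num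
      _ = 1 := ENNReal.inv_two_add_inv_two
  exact absurd h5 (not_le.2 h6)

theorem mul_inv_le_inv {a b n : ℕ} (ha : a ≠ 0) (h : a * b ≤ n) :
    (a : ℝ≥0∞) * (n : ℝ≥0∞)⁻¹ ≤ (b : ℝ≥0∞)⁻¹ := by
  have ha' : (a : ℝ≥0∞) ≠ 0 := by simpa using ha
  calc (a : ℝ≥0∞) * (n : ℝ≥0∞)⁻¹ ≤ a * ((a * b : ℕ) : ℝ≥0∞)⁻¹ := by
        gcongr
    _ = (b : ℝ≥0∞)⁻¹ := by
        push_cast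
        rw [ENNReal.mul_inv (by simp) (by simp), ← mul_assoc,
          ENNReal.mul_inv_cancel ha' (by simp), one_mul]

theorem exists_energy_of_loneBefore {P : Criterion R M Out} {T : ℕ → ℕ}
    (hA : A.Solves model P T) (hP : P.Terminating)
    (hlone : ∀ n F F' d (σ : Fin n → History R M) s, P A n σ → Unaffected F F' d (σ s) →
      LoneBefore d σ)
    (hD : Monotone D) {i₀ E : ℕ} (h3 : 3 ≤ D i₀) (hE : 2 ^ E ≤ D i₀)
    (hN : ∀ i, i₀ ≤ i → PredictableNetwork A model (D i) (n i) (F i))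
    (hT : ∀ i, i₀ ≤ i → T (n i) ≤ D (i + 1)) :
    ∃ i, i₀ ≤ i ∧ i < i₀ + 2 ^ E ∧ 1 - ((n i : ℝ≥0∞) ^ 7)⁻¹ ≤
      ex (A.run model (n i) (D i)) fun σ => ind (∃ s, E ≤ energy (σ s)) := by
  by_contra! hcost
  obtain ⟨i, j, hi, hij, hgt⟩ := exists_pairProb_gt hD h3 hE hN hcost
  have hNi := hN i hi
  have hdi : 3 ≤ D i := h3.trans (hD hi)
  have hKi : 2 ^ E ≤ D i := hE.trans (hD hi)
  have hsq := hNi.mul_sq_le hdi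
  have hn1 : 1 ≤ n i := by nlinarith
  refine absurd hgt (not_lt.2 ?_)
  -- The pair probability was measured under `F j`; it is moved to `F i`, where the algorithm must
  -- finish by `D (i + 1)`.
  rw [← ex_devRun_eq_of_unaffected (F := F i) (F' := F j) (d := D i) _
    fun h hh => ind_false hh]
  refine (hNi.predicts.ex_unaffected_le (hD (Nat.le_succ i)) ⟨0, hn1⟩ (fun h => ind_le_one _)
    fun h hh => ind_false hh).trans ?_
  have hle : (ex (A.run model (n i) (D (i + 1))) fun σ =>
      ind (Unaffected (F i) (F j) (D i) (σ ⟨0, hn1⟩))) ≤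
      (n i : ℝ≥0∞)⁻¹ + (n i : ℝ≥0∞)⁻¹ := by
    calc _ ≤ (ex (A.run model (n i) (D (i + 1))) fun σ => ind (¬ P A (n i) σ)) +
          ex (A.run model (n i) (D (i + 1))) fun σ => ind (LoneBefore (D i) σ) := by
          rw [← ex_add]
          refine ex_mono fun σ => (ind_mono fun hσ => ?_).trans (ind_or_le _ _)
          by_cases hPσ : P A (n i) σ
          · exact Or.inr (hlone _ _ _ _ _ _ hPσ hσ)
          · exact Or.inl hPσ
      _ ≤ _ := by
          refine add_le_add (hA.ex_not_le hP hn1 (hT i hi)) ?_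
          refine (hNi.predicts.ex_loneBefore_le _).trans ?_
          rw [min_eq_right (hD (Nat.le_succ i))]
          exact hNi.mul_mul_error_le hdi
  calc _ ≤ (n i : ℝ≥0∞)⁻¹ + (n i : ℝ≥0∞)⁻¹ + (n i : ℝ≥0∞)⁻¹ :=
        add_le_add hle (hNi.mul_error_le_inv hdi)
    _ = ((3 : ℕ) : ℝ≥0∞) * (n i : ℝ≥0∞)⁻¹ := by push_cast; ring
    _ ≤ _ := by
        refine mul_inv_le_inv (by norm_num) ?_
        have := Nat.pow_le_pow_left hKi 2
        omega

/-- An unseparated device either fails to output an estimate at most `c * n i` by `D (i + 1)`, which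
is unlikely under `F i`, or outputs one, which is unlikely under `F j` because `c * n i < n j / c`.
-/
theorem exists_energy_of_approximateCounting {A : Algorithm R M ℝ} {c : ℝ} (hc : 1 ≤ c)
    {T : ℕ → ℕ} (hA : A.Solves model (ApproximateCounting c) T)
    (hD : Monotone D) {i₀ E : ℕ} (h3 : 3 ≤ D i₀) (hE : 2 ^ E ≤ D i₀)
    (hN : ∀ i, i₀ ≤ i → PredictableNetwork A model (D i) (n i) (F i))
    (hT : ∀ i, i₀ ≤ i → T (n i) ≤ D (i + 1))
    (hgrow : ∀ i j, i₀ ≤ i → i < j → c ^ 2 * n i < n j) :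
    ∃ i, i₀ ≤ i ∧ i < i₀ + 2 ^ E ∧ 1 - ((n i : ℝ≥0∞) ^ 7)⁻¹ ≤
      ex (A.run model (n i) (D i)) fun σ => ind (∃ s, E ≤ energy (σ s)) := by
  have hP : Criterion.Terminating (ApproximateCounting c : Criterion R M ℝ) := by
    rintro A n σ ⟨est, -, -, h⟩ s
    simp [h s]
  by_contra! hcost
  obtain ⟨i, j, hi, hij, hgt⟩ := exists_pairProb_gt hD h3 hE hN hcost
  have hj : i₀ ≤ j := by omega
  have hNi := hN i hi
  have hNj := hN j hj
  have hdi : 3 ≤ D i := h3.trans (hD hi)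
  have hdj : 3 ≤ D j := h3.trans (hD hj)
  have hKi : 2 ^ E ≤ D i := hE.trans (hD hi)
  have hsq := hNi.mul_sq_le hdi
  have hsqj := hNj.mul_sq_le hdj
  have hn1 : 1 ≤ n i := by nlinarith
  have hnj1 : 1 ≤ n j := by nlinarith
  have hg := hgrow i j hi hij
  have hnij : n i ≤ n j := by
    have h1 : (n i : ℝ) ≤ c ^ 2 * n i := le_mul_of_one_le_left (by positivity) (one_le_pow₀ hc)
    exact_mod_cast (h1.trans_lt hg).le
  refine absurd hgt (not_lt.2 ?_)
  set G : History R M → Prop := fun h => ∃ est, A.output h = some est ∧ est ≤ c * n i with hG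
  have hsmall : (ex (A.devRun model (F j) (D (i + 1)) []) fun h =>
      ind (Unaffected (F i) (F j) (D i) h ∧ ¬ G h)) ≤ (n i : ℝ≥0∞)⁻¹ + (n i : ℝ≥0∞)⁻¹ := by
    rw [← ex_devRun_eq_of_unaffected (F := F i) (F' := F j) (d := D i) _
      fun h hh => ind_false fun H => hh H.1]
    refine (hNi.predicts.ex_unaffected_le (F' := F j) (hD (Nat.le_succ i)) ⟨0, hn1⟩
      (fun h => ind_le_one _) fun h hh => ind_false fun H => hh H.1).trans ?_
    refine add_le_add ?_ (hNi.mul_error_le_inv hdi)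
    refine (ex_mono fun σ => ind_mono ?_).trans (hA.ex_not_le hP hn1 (hT i hi))
    rintro ⟨-, hnG⟩ ⟨est, -, hle, hout⟩
    exact hnG ⟨est, hout _, hle⟩
  -- Since `D (i + 1) ≤ D j`, network `j` is still predictable at this time; the premature output
  -- then persists until `D (j + 1)`, when it must be correct.
  have hlarge : (ex (A.devRun model (F j) (D (i + 1)) []) fun h => ind (G h)) ≤
      (n j : ℝ≥0∞)⁻¹ + (n j : ℝ≥0∞)⁻¹ := by
    rw [← ex_indep_apply (fun _ : Fin (n j) => A.devRun model (F j) (D (i + 1)) []) ⟨0, hnj1⟩]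
    refine (hNj.predicts.le_ex_run (hD hij) fun σ => ind_le_one _).trans ?_
    refine add_le_add ?_ (le_trans ?_ (hNj.mul_error_le_inv hdj))
    · have h1 := ex_run_mono_of_closed (A := A) (model := model) (n := n j)
        (W := fun σ => G (σ ⟨0, hnj1⟩)) (t := D (i + 1)) (t' := D (j + 1))
        (fun σ hσ σ' hσ' => by
          have hne : A.output (σ ⟨0, hnj1⟩) ≠ none := by
            obtain ⟨est, he, -⟩ := hσ
            simp [he]
          rw [step_eq_of_terminal hσ' hne]
          exact hσ) (hD (by omega))
      refine h1.trans ((ex_mono fun σ => ind_mono ?_).trans (hA.ex_not_le hP hnj1 (hT j hj)))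
      rintro ⟨est, he, hle⟩ ⟨est', hge, -, hout⟩
      rw [hout] at he
      obtain rfl : est' = est := by simpa using he
      have hc0 : 0 < c := by linarith
      rw [div_le_iff₀ hc0] at hge
      nlinarith
    · have : D (i + 1) ≤ D j := hD hij
      gcongr
  have hsplit : (ex (A.devRun model (F j) (D (i + 1)) []) fun h =>
      ind (Unaffected (F i) (F j) (D i) h)) ≤
      ((n i : ℝ≥0∞)⁻¹ + (n i : ℝ≥0∞)⁻¹) + ((n i : ℝ≥0∞)⁻¹ + (n i : ℝ≥0∞)⁻¹) := by
    calc _ ≤ (ex (A.devRun model (F j) (D (i + 1)) []) fun h =>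
          ind (Unaffected (F i) (F j) (D i) h ∧ ¬ G h)) +
          ex (A.devRun model (F j) (D (i + 1)) []) fun h => ind (G h) := by
          rw [← ex_add]
          refine ex_mono fun h => (ind_mono fun hh => ?_).trans (ind_or_le _ _)
          by_cases hGh : G h
          · exact Or.inr hGh
          · exact Or.inl ⟨hh, hGh⟩
      _ ≤ _ := by
          refine add_le_add hsmall (hlarge.trans ?_)
          gcongr
  calc _ ≤ _ := hsplit
    _ = ((4 : ℕ) : ℝ≥0∞) * (n i : ℝ≥0∞)⁻¹ := by push_cast; ring
    _ ≤ _ := by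
        refine mul_inv_le_inv (by norm_num) ?_
        have := Nat.pow_le_pow_left hKi 2
        omega

end Pairs

theorem ex_energy_le_probEnergyAtLeast {n t E : ℕ} {x : ℝ} (hx : x ≤ E) :
    (ex (A.run model n t) fun σ => ind (∃ s, E ≤ energy (σ s))) ≤
      A.probEnergyAtLeast model n x := by
  refine le_trans ?_ (le_iSup _ t)
  rw [toOuterMeasure_eq_ex]
  refine ex_mono fun σ => ind_mono ?_
  rintro ⟨s, hs⟩
  exact ⟨s, hx.trans (by exact_mod_cast hs)⟩

/-! ### Energy bounds along growing deadlines. -/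

section Growth

variable {D : ℕ → ℕ}

theorem lt_two_pow_four (y : ℕ) : y < 2 ^ 2 ^ 2 ^ 2 ^ y := by
  have h1 : y < 2 ^ y := Nat.lt_two_pow_self
  have h2 : 2 ^ y < 2 ^ 2 ^ y := Nat.lt_two_pow_self
  have h3 : 2 ^ 2 ^ y < 2 ^ 2 ^ 2 ^ y := Nat.lt_two_pow_self
  have h4 : 2 ^ 2 ^ 2 ^ y < 2 ^ 2 ^ 2 ^ 2 ^ y := Nat.lt_two_pow_self
  omega

theorem strictMono_of_growth (hD : ∀ i, 2 ^ 2 ^ 2 ^ 2 ^ D i ≤ D (i + 1)) : StrictMono D :=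
  strictMono_nat_of_lt_succ fun i => (lt_two_pow_four (D i)).trans_le (hD i)

/-- Among the network sizes between `D i₀` and `D (i₀ + 2 ^ E)` there is one for which some device
spends `E` units of energy with high probability. -/
def EnergyBound (A : Algorithm R M Out) (model : CDModel) (D : ℕ → ℕ) : Prop :=
  ∀ i₀ E : ℕ, 2 ^ E ≤ D i₀ → ∀ x : ℝ, x ≤ E → ∃ n, D i₀ ≤ n ∧ n ≤ D (i₀ + 2 ^ E) ∧
    1 - ((n : ℝ≥0∞) ^ 7)⁻¹ ≤ A.probEnergyAtLeast model n x

theorem energyBound_of_exists (hD : ∀ i, 2 ^ 2 ^ 2 ^ 2 ^ D i ≤ D (i + 1)) (h3 : 3 ≤ D 0)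
    (H : ∀ (n : ℕ → ℕ) (F : ℕ → ℕ → Bool),
      (∀ i, PredictableNetwork A model (D i) (n i) (F i)) → ∀ i₀ E : ℕ, 2 ^ E ≤ D i₀ →
      ∃ i, i₀ ≤ i ∧ i < i₀ + 2 ^ E ∧ 1 - ((n i : ℝ≥0∞) ^ 7)⁻¹ ≤
        ex (A.run model (n i) (D i)) fun σ => ind (∃ s, E ≤ energy (σ s))) :
    EnergyBound A model D := by
  intro i₀ E hE x hx
  have hmono := (strictMono_of_growth hD).monotone
  have h3i : ∀ i, 3 ≤ D i := fun i => h3.trans (hmono (Nat.zero_le i))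
  choose n F hN using fun i => exists_predictableNetwork A model (h3i i)
  obtain ⟨i, hi, hi', hle⟩ := H n F hN i₀ E hE
  refine ⟨n i, ?_, ?_, hle.trans (ex_energy_le_probEnergyAtLeast hx)⟩
  · refine (hmono hi).trans ?_
    have := (hN i).mul_sq_le (h3i i)
    nlinarith
  · exact ((hN i).upper.trans (hD i)).trans (hmono hi')

theorem energyBound_of_loneBefore {P : Criterion R M Out} {T : ℕ → ℕ}
    (hD : ∀ i, 2 ^ 2 ^ 2 ^ 2 ^ D i ≤ D (i + 1)) (h3 : 3 ≤ D 0)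
    (hA : A.Solves model P T) (hP : P.Terminating)
    (hlone : ∀ n F F' d (σ : Fin n → History R M) s, P A n σ → Unaffected F F' d (σ s) →
      LoneBefore d σ)
    (hT : ∀ i, ∀ m ≤ 2 ^ 2 ^ 2 ^ 2 ^ D i, T m ≤ D (i + 1)) : EnergyBound A model D := by
  have hmono := (strictMono_of_growth hD).monotone
  exact energyBound_of_exists hD h3 fun n F hN i₀ E hE =>
    exists_energy_of_loneBefore hA hP hlone hmono (h3.trans (hmono (Nat.zero_le _))) hE
      (fun i _ => hN i) fun i _ => hT i _ (hN i).upper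

theorem energyBound_of_approximateCounting {A : Algorithm R M ℝ} {c : ℝ} (hc : 1 ≤ c)
    {T : ℕ → ℕ} (hD : ∀ i, 2 ^ 2 ^ 2 ^ 2 ^ D i ≤ D (i + 1)) (h3 : 3 ≤ D 0) (hcD : c ≤ D 0)
    (hA : A.Solves model (ApproximateCounting c) T)
    (hT : ∀ i, ∀ m ≤ 2 ^ 2 ^ 2 ^ 2 ^ D i, T m ≤ D (i + 1)) : EnergyBound A model D := by
  have hmono := (strictMono_of_growth hD).monotone
  have h3i : ∀ i, 3 ≤ D i := fun i => h3.trans (hmono (Nat.zero_le i))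
  refine energyBound_of_exists hD h3 fun n F hN i₀ E hE =>
    exists_energy_of_approximateCounting hc hA hmono (h3i _) hE
      (fun i _ => hN i) (fun i _ => hT i _ (hN i).upper) fun i j _ hij => ?_
  have h1 : (32 * (D i : ℝ) ^ 2) ≤ n i := by exact_mod_cast (hN i).mul_sq_le (h3i i)
  have h2 : (32 * (D j : ℝ) ^ 2) ≤ n j := by exact_mod_cast (hN j).mul_sq_le (h3i j)
  have h4 : (n i : ℝ) ≤ D j := by
    exact_mod_cast ((hN i).upper.trans (hD i)).trans (hmono hij)
  have h5 : c ≤ D i := hcD.trans (by exact_mod_cast hmono (Nat.zero_le i))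
  have h6 : (3 : ℝ) ≤ D i := by exact_mod_cast h3i i
  have h7 : c ^ 2 ≤ n i := by nlinarith
  have h8 : (0 : ℝ) < n i := by nlinarith
  calc c ^ 2 * n i ≤ n i * n i := by gcongr
    _ ≤ D j * D j := by gcongr
    _ < 32 * (D j : ℝ) ^ 2 := by nlinarith
    _ ≤ n j := h2

end Growth

/-! ### Leader Election and contention resolution force a lone transmission. -/

section Problems

theorem Unaffected.lt_of_transmitsAt {F F' : ℕ → Bool} {d t : ℕ} {h : History R M}
    (hU : Unaffected F F' d h) (ht : TransmitsAt h t) : t < d := by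
  obtain ⟨e, he, m, hm⟩ := ht
  rcases hU t e he with h | h
  · simp [hm] at h
  · exact h.1

theorem Unaffected.lt_of_listensAt {F F' : ℕ → Bool} {d t : ℕ} {h : History R M}
    (hU : Unaffected F F' d h) (ht : ListensAt h t) : t < d := by
  obtain ⟨e, he, hl⟩ := ht
  rcases hU t e he with h | h
  · simp [hl] at h
  · exact h.1

theorem ListensAt.not_transmitsAt {h : History R M} {t : ℕ} (ht : ListensAt h t) :
    ¬ TransmitsAt h t := by
  obtain ⟨e, he, hl⟩ := ht
  rintro ⟨e', he', m, hm⟩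
  obtain rfl : e = e' := by simpa [he] using he'
  simp [hl] at hm

theorem leaderElection_terminating :
    Criterion.Terminating (LeaderElection : Criterion R M Role) := by
  rintro A n σ ⟨l, hl, hf, -⟩ s
  by_cases hs : s = l
  · simp [hs, hl]
  · simp [hf s hs]

/-- In the final slot every device is active, so a single unaffected device forces that slot, with
its lone transmission, to lie before `d`. -/
theorem loneBefore_of_leaderElection {A : Algorithm R M Role} {n d : ℕ} {F F' : ℕ → Bool}
    {σ : Fin n → History R M} {s : Fin n} (h : LeaderElection A n σ)
    (hU : Unaffected F F' d (σ s)) : LoneBefore d σ := by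
  obtain ⟨l, -, -, t, -, htr, hli⟩ := h
  refine ⟨t, ?_, l, htr, fun s' hs' => (hli s' hs').not_transmitsAt⟩
  by_cases hs : s = l
  · exact hU.lt_of_transmitsAt (hs ▸ htr)
  · exact hU.lt_of_listensAt (hli s hs)

theorem contentionResolution_terminating :
    Criterion.Terminating (ContentionResolution : Criterion R M Out) :=
  fun _ _ _ h s => Option.isSome_iff_ne_none.1 (h s).1

theorem loneBefore_of_contentionResolution {n d : ℕ} {F F' : ℕ → Bool}
    {σ : Fin n → History R M} {s : Fin n} (h : ContentionResolution A n σ)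
    (hU : Unaffected F F' d (σ s)) : LoneBefore d σ := by
  obtain ⟨-, t, htr, hun⟩ := h s
  exact ⟨t, hU.lt_of_transmitsAt htr, s, htr, hun⟩

end Problems

/-! ### Polynomial time, towers and the iterated logarithm. -/

section PolynomialTime

theorem eventually_eval_le_two_pow (p : Polynomial ℕ) :
    ∀ᶠ y : ℕ in Filter.atTop, p.eval y ≤ 2 ^ y := by
  -- The free factor `c` makes the sum step work: each summand is used with `2 * c`.
  suffices H : ∀ c : ℕ, ∀ᶠ y : ℕ in Filter.atTop, c * p.eval y ≤ 2 ^ y by simpa using H 1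
  induction p using Polynomial.induction_on' with
  | add p q hp hq =>
    intro c
    filter_upwards [hp (2 * c), hq (2 * c)] with y h1 h2
    rw [Polynomial.eval_add]
    nlinarith
  | monomial k a =>
    intro c
    have h := tendsto_pow_const_div_const_pow_of_one_lt k (one_lt_two : (1 : ℝ) < 2)
    have hpos : (0 : ℝ) < 1 / (c * a + 1) := by positivity
    filter_upwards [h.eventually_lt_const hpos] with y hy
    rw [Polynomial.eval_monomial]
    rw [div_lt_div_iff₀ (by positivity) (by positivity)] at hy
    have h1 : ((c * (a * y ^ k) : ℕ) : ℝ) ≤ ((2 ^ y : ℕ) : ℝ) := by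
      push_cast
      have : (0 : ℝ) ≤ (y : ℝ) ^ k := by positivity
      nlinarith
    exact_mod_cast h1

/-- The tower of twos of the given height. -/
def tower : ℕ → ℕ
  | 0 => 1
  | m + 1 => 2 ^ tower m

theorem le_tower (m : ℕ) : m ≤ tower m := by
  induction m with
  | zero => exact Nat.zero_le _
  | succ m ih => exact Nat.succ_le_of_lt (ih.trans_lt Nat.lt_two_pow_self)

theorem exists_iterate_logb_le_one {m : ℕ} {x : ℝ} (hx : x ≤ tower m) :
    ∃ k ≤ m, (Real.logb 2)^[k] x ≤ 1 := by
  induction m generalizing x with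
  | zero => exact ⟨0, le_rfl, by simpa [tower] using hx⟩
  | succ m ih =>
    by_cases h1 : x ≤ 1
    · exact ⟨0, Nat.zero_le _, h1⟩
    · obtain ⟨k, hk, hle⟩ := ih (x := Real.logb 2 x) (by
        rw [Real.logb_le_iff_le_rpow one_lt_two (by linarith), Real.rpow_natCast]
        simpa [tower] using hx)
      exact ⟨k + 1, by omega, by simpa using hle⟩

theorem logStar_le {n m : ℕ} (h : n ≤ tower m) : logStar n ≤ m := by
  obtain ⟨k, hk, hle⟩ := exists_iterate_logb_le_one (m := m) (x := n) (by exact_mod_cast h)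
  exact (Nat.sInf_le hle).trans hk

/-- Rapidly growing checkpoints. -/
def towerCheckpoint (d : ℕ) : ℕ → ℕ
  | 0 => d
  | i + 1 => 2 ^ 2 ^ 2 ^ 2 ^ 2 ^ towerCheckpoint d i

theorem towerCheckpoint_le_tower (d i : ℕ) : towerCheckpoint d i ≤ tower (d + 5 * i) := by
  induction i with
  | zero => exact le_tower d
  | succ i ih =>
    rw [show d + 5 * (i + 1) = d + 5 * i + 1 + 1 + 1 + 1 + 1 by ring]
    simp only [towerCheckpoint, tower]
    gcongr <;> norm_num

theorem towerCheckpoint_growth (d i : ℕ) :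
    2 ^ 2 ^ 2 ^ 2 ^ towerCheckpoint d i ≤ towerCheckpoint d (i + 1) := by
  have : towerCheckpoint d i ≤ 2 ^ towerCheckpoint d i := Nat.lt_two_pow_self.le
  simp only [towerCheckpoint]
  gcongr <;> norm_num

/-- As `log 2 ≤ 1`, the left side is at most `4 * √k`, and `4 * √k ≤ k` from 16 on. -/
theorem two_mul_two_pow_ceil_le {k : ℕ} (hk : 16 ≤ k) {y : ℝ} (hy0 : 0 ≤ y)
    (hy : y ≤ Real.log k / 2) : 2 * 2 ^ ⌈y⌉₊ ≤ k := by
  have hk0 : (0 : ℝ) < k := by positivity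
  have h1 : ((2 : ℝ) ^ ⌈y⌉₊) ≤ 2 * Real.exp (Real.log k / 2) := by
    have hE : (⌈y⌉₊ : ℝ) ≤ y + 1 := (Nat.ceil_lt_add_one hy0).le
    calc ((2 : ℝ) ^ ⌈y⌉₊) = (2 : ℝ) ^ ((⌈y⌉₊ : ℕ) : ℝ) := (Real.rpow_natCast _ _).symm
      _ ≤ (2 : ℝ) ^ (y + 1) := Real.rpow_le_rpow_of_exponent_le one_le_two hE
      _ = 2 * (2 : ℝ) ^ y := by rw [Real.rpow_add two_pos, Real.rpow_one, mul_comm]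
      _ ≤ 2 * Real.exp (Real.log k / 2) := by
          rw [Real.rpow_def_of_pos two_pos]
          gcongr
          have : Real.log 2 ≤ 1 := by linarith [Real.log_two_lt_d9]
          nlinarith
  have h2 : Real.exp (Real.log k / 2) ^ 2 = k := by
    rw [← Real.exp_nat_mul]
    push_cast
    rw [mul_div_cancel₀ _ two_ne_zero, Real.exp_log hk0]
  have h3 : (2 * 2 ^ ⌈y⌉₊ : ℝ) ^ 2 ≤ (k : ℝ) ^ 2 := by
    have h16 : (16 : ℝ) ≤ k := by exact_mod_cast hk
    calc (2 * 2 ^ ⌈y⌉₊ : ℝ) ^ 2 ≤ (2 * (2 * Real.exp (Real.log k / 2))) ^ 2 := by gcongr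
      _ = 16 * (k : ℝ) := by rw [mul_pow, mul_pow, h2]; ring
      _ ≤ (k : ℝ) ^ 2 := by nlinarith
  have h4 := le_of_sq_le_sq h3 hk0.le
  exact_mod_cast h4

theorem energyCostAtLeast_of_energyBound {d : ℕ} (hd : 2 ≤ d)
    (h : EnergyBound A model (towerCheckpoint d)) :
    A.EnergyCostAtLeast model fun n => 1 / 4 * Real.log (logStar n) := by
  set D := towerCheckpoint d with hDdef
  have hmono := strictMono_of_growth (towerCheckpoint_growth d)
  rw [← hDdef] at hmono
  rw [Algorithm.EnergyCostAtLeast, Filter.eventually_atTop]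
  -- For `k ≥ d + 16` one has `d + 5 * (k + 1) ≤ k ^ 2`, so `log (logStar n) ≤ 2 * log k`; also `k ≥
  -- 16`, as `two_mul_two_pow_ceil_le` needs.
  refine ⟨D (d + 16), fun n hn => ?_⟩
  obtain ⟨k, hk0, hk1, hk2⟩ : ∃ k, d + 16 ≤ k ∧ D k ≤ n ∧ n < D (k + 1) := by
    by_contra! H
    have hall : ∀ k, d + 16 ≤ k → D k ≤ n := fun k hk => by
      induction k, hk using Nat.le_induction with
      | base => exact hn
      | succ k hk ih => exact H k hk ih
    have h1 := hall (d + 16 + n + 1) (by omega)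
    have h2 := hmono.le_apply (x := d + 16 + n + 1)
    omega
  have hls : logStar n ≤ d + 5 * (k + 1) :=
    logStar_le (hk2.le.trans (towerCheckpoint_le_tower d (k + 1)))
  have hls2 : logStar n ≤ k ^ 2 := by nlinarith
  have hkpos : (1 : ℝ) ≤ k := by exact_mod_cast (by omega : 1 ≤ k)
  have hlog : 1 / 4 * Real.log (logStar n) ≤ Real.log k / 2 := by
    have hle : Real.log (logStar n) ≤ Real.log ((k : ℝ) ^ 2) := by
      rcases Nat.eq_zero_or_pos (logStar n) with h0 | h0
      · rw [h0]
        simpa using Real.log_nonneg hkpos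
      · exact Real.log_le_log (by exact_mod_cast h0) (by exact_mod_cast hls2)
    rw [Real.log_pow] at hle
    push_cast at hle
    linarith
  have hE := two_mul_two_pow_ceil_le (k := k) (by omega)
    (by have := Real.log_nonneg hkpos; positivity : 0 ≤ Real.log k / 2) le_rfl
  set E := ⌈Real.log k / 2⌉₊ with hEdef
  -- The block of `2 ^ E` deadlines ends at `k`, to stay below `n`. Since `2 * 2 ^ E ≤ k`, its start
  -- satisfies `D (k - 2 ^ E) ≥ k - 2 ^ E ≥ 2 ^ E`.
  obtain ⟨n', h1, h2, h3⟩ := h (k - 2 ^ E) E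
    (by have := hmono.le_apply (x := k - 2 ^ E); omega)
    (1 / 4 * Real.log (logStar n)) (hlog.trans (Nat.le_ceil _))
  rw [show k - 2 ^ E + 2 ^ E = k by omega] at h2
  refine ⟨n', ?_, h2.trans hk1, h3⟩
  exact hd.trans ((hmono.monotone (Nat.zero_le (k - 2 ^ E))).trans h1)

/-- Four exponentials bound the network size; the fifth in `towerCheckpoint` absorbs the polynomial.
-/
theorem PolyTime.exists_towerCheckpoint {T : ℕ → ℕ} (hT : PolyTime T) (b : ℕ) :
    ∃ d, b ≤ d ∧ ∀ i, ∀ m ≤ 2 ^ 2 ^ 2 ^ 2 ^ towerCheckpoint d i,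
      T m ≤ towerCheckpoint d (i + 1) := by
  obtain ⟨p, hp⟩ := hT
  obtain ⟨a, ha⟩ := Filter.eventually_atTop.1 (eventually_eval_le_two_pow p)
  refine ⟨max a b, le_max_right _ _, fun i m hm => ?_⟩
  have hmono := strictMono_of_growth (towerCheckpoint_growth (max a b))
  have h1 : a ≤ towerCheckpoint (max a b) i :=
    (le_max_left a b).trans (hmono.monotone (Nat.zero_le i))
  calc T m ≤ p.eval m := hp m
    _ ≤ p.eval (2 ^ 2 ^ 2 ^ 2 ^ towerCheckpoint (max a b) i) := by
        simp only [Polynomial.eval_eq_sum_range]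
        exact Finset.sum_le_sum fun j _ => Nat.mul_le_mul_left _ (Nat.pow_le_pow_left hm j)
    _ ≤ 2 ^ 2 ^ 2 ^ 2 ^ 2 ^ towerCheckpoint (max a b) i :=
        ha _ (h1.trans (lt_two_pow_four _).le)
    _ = _ := rfl

theorem energyCostAtLeast_of_loneBefore {P : Criterion R M Out} {T : ℕ → ℕ} (hT : PolyTime T)
    (hA : A.Solves model P T) (hP : P.Terminating)
    (hlone : ∀ n F F' d (σ : Fin n → History R M) s, P A n σ → Unaffected F F' d (σ s) →
      LoneBefore d σ) :
    A.EnergyCostAtLeast model fun n => 1 / 4 * Real.log (logStar n) := by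
  obtain ⟨d, hd, hTd⟩ := hT.exists_towerCheckpoint 3
  exact energyCostAtLeast_of_energyBound (by omega)
    (energyBound_of_loneBefore (towerCheckpoint_growth d) hd hA hP hlone hTd)

end PolynomialTime

theorem EnergyBound.exists_of_strictMono {D : ℕ → ℕ} (h : EnergyBound A model D)
    (hD : StrictMono D) (h2 : 2 ≤ D 0) {k : ℕ} (hk : 3 ≤ k) :
    ∃ n, D 0 ≤ n ∧ n ≤ D k ∧
      1 - ((n : ℝ≥0∞) ^ 7)⁻¹ ≤ A.probEnergyAtLeast model n (1 / 4 * Real.log k) := by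
  have hkpos : (1 : ℝ) ≤ k := by exact_mod_cast (by omega : 1 ≤ k)
  have hlog := Real.log_nonneg hkpos
  suffices H : ∃ E : ℕ, 1 / 4 * Real.log k ≤ E ∧ 2 ^ E ≤ k ∧ 2 ^ E ≤ D (k - 2 ^ E) by
    obtain ⟨E, hE, hEk, hED⟩ := H
    obtain ⟨n, h1, h3, h4⟩ := h (k - 2 ^ E) E hED _ hE
    rw [Nat.sub_add_cancel hEk] at h3
    exact ⟨n, (hD.monotone (Nat.zero_le _)).trans h1, h3, h4⟩
  by_cases h16 : 16 ≤ k
  · have hE := two_mul_two_pow_ceil_le h16 (by positivity : 0 ≤ 1 / 4 * Real.log k)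
      (by linarith)
    have := hD.le_apply (x := k - 2 ^ ⌈1 / 4 * Real.log k⌉₊)
    exact ⟨_, Nat.le_ceil _, by omega, by omega⟩
  -- For `k ≤ 16` one unit suffices, because `log k / 4 ≤ log 2 < 1`.
  · refine ⟨1, ?_, by omega, h2.trans (hD.monotone (Nat.zero_le _))⟩
    have h1 : Real.log k ≤ Real.log ((2 : ℝ) ^ 4) := by
      refine Real.log_le_log (by linarith) ?_
      have : (k : ℝ) ≤ 16 := by exact_mod_cast (by omega : k ≤ 16)
      linarith
    rw [Real.log_pow] at h1
    push_cast at h1 ⊢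
    linarith [Real.log_two_lt_d9]

end RadioNet

end

/-! ### The main theorem. -/

theorem mainTheorem2 :
    ∃ κ : ℝ, 0 < κ ∧
      -- polynomial time Approximate Counting
      (∀ (R : Type u) (M : Type v) (model : RadioNet.CDModel) (A : RadioNet.Algorithm R M ℝ)
        (c : ℝ) (T : ℕ → ℕ), 1 ≤ c → RadioNet.PolyTime T →
        A.Solves model (RadioNet.ApproximateCounting c) T →
        A.EnergyCostAtLeast model fun n => κ * Real.log (RadioNet.logStar n)) ∧
      -- polynomial time Leader Election
      (∀ (R : Type u) (M : Type v) (model : RadioNet.CDModel)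
        (A : RadioNet.Algorithm R M RadioNet.Role) (T : ℕ → ℕ), RadioNet.PolyTime T →
        A.Solves model RadioNet.LeaderElection T →
        A.EnergyCostAtLeast model fun n => κ * Real.log (RadioNet.logStar n)) ∧
      -- polynomial time contention resolution
      (∀ (R : Type u) (M : Type v) (Out : Type w) (model : RadioNet.CDModel)
        (A : RadioNet.Algorithm R M Out) (T : ℕ → ℕ), RadioNet.PolyTime T →
        A.Solves model RadioNet.ContentionResolution T →
        A.EnergyCostAtLeast model fun n => κ * Real.log (RadioNet.logStar n)) ∧
      -- the detailed form, for Approximate Counting with an arbitrary time bound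
      (∀ c : ℝ, 1 ≤ c → ∃ D : ℕ, ∀ d : ℕ, D ≤ d →
        ∀ (R : Type u) (M : Type v) (model : RadioNet.CDModel) (A : RadioNet.Algorithm R M ℝ)
          (T : ℕ → ℕ), Monotone T → (∀ n, n ≤ T n) →
          A.Solves model (RadioNet.ApproximateCounting c) T →
          ∀ k : ℕ, 3 ≤ k → ∃ n : ℕ,
            RadioNet.checkpoint T d 0 ≤ n ∧ n ≤ RadioNet.checkpoint T d k ∧
            1 - ((n : ℝ≥0∞) ^ 7)⁻¹ ≤ A.probEnergyAtLeast model n (κ * Real.log k)) := by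
  refine ⟨1 / 4, by norm_num, ?_, ?_, ?_, ?_⟩
  · intro R M model A c T hc hT hA
    obtain ⟨d, hd, hTd⟩ := hT.exists_towerCheckpoint (max 3 ⌈c⌉₊)
    have h3 : 3 ≤ d := (le_max_left _ _).trans hd
    have hcd : c ≤ d := Nat.ceil_le.1 ((le_max_right _ _).trans hd)
    exact RadioNet.energyCostAtLeast_of_energyBound (by omega)
      (RadioNet.energyBound_of_approximateCounting hc (RadioNet.towerCheckpoint_growth d) h3 hcd
        hA hTd)
  · intro R M model A T hT hA
    exact RadioNet.energyCostAtLeast_of_loneBefore hT hA RadioNet.leaderElection_terminating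
      fun _ _ _ _ _ _ => RadioNet.loneBefore_of_leaderElection
  · intro R M Out model A T hT hA
    exact RadioNet.energyCostAtLeast_of_loneBefore hT hA RadioNet.contentionResolution_terminating
      fun _ _ _ _ _ _ => RadioNet.loneBefore_of_contentionResolution
  · intro c hc
    refine ⟨max 3 ⌈c⌉₊, fun d hd R M model A T hT hTn hA k hk => ?_⟩
    have h3 : 3 ≤ d := (le_max_left _ _).trans hd
    have hcd : c ≤ d := Nat.ceil_le.1 ((le_max_right _ _).trans hd)
    have hgrow : ∀ i, 2 ^ 2 ^ 2 ^ 2 ^ RadioNet.checkpoint T d i ≤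
        RadioNet.checkpoint T d (i + 1) := fun i => hTn _
    exact (RadioNet.energyBound_of_approximateCounting hc hgrow h3 hcd hA
      fun i m hm => hT hm).exists_of_strictMono (RadioNet.strictMono_of_growth hgrow)
        (show 2 ≤ d by omega) hk
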